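/- On $\mathbb C^2$ with coordinates $z^1,z^2$, write a Hermitian metric as $g=(g_{i\bar j})$, with inverse $g^{\bar j i}$ and Kähler form $\omega=\frac{\sqrt{-1}}{2}\sum g_{i\bar j}\,dz^i\wedge d\bar z^j$; let $g_E$ be the standard metric, $(g_E)_{i\bar j}=\delta_{ij}$. Let $\partial^*_\omega,\bar\partial^*_\omega$ be the formal adjoints of $\partial,\bar\partial$ with respect to the volume density $\det g$ and the pairings of forms obtained by contracting indices with $g^{\bar j i}$, and put $$P(\omega)=-\partial\partial^*_\omega\omega-\bar\partial\bar\partial^*_\omega\omega-\tfrac{\sqrt{-1}}{2}\,\partial\bar\partial\log\det g .$$ Let $g_t$, $t\in(-\infty,0]$, be a smooth family of pluriclosed Hermitian metrics on $\mathbb C^2$ (that is, $\partial\bar\partial\omega_t=0$) that solves the pluriclosed flow $\frac{\partial}{\partial t}\omega_t=-P(\omega_t)$ on $\mathbb C^2\times(-\infty,0]$. Suppose that there is a constant $A>0$, and for each $k\in\mathbb N$ a constant $C_k$, such that on $\mathbb C^2\times(-\infty,0]$ $$A^{-1}g_E\le g_t\le A\,g_E,\qquad |g_t|_{C^k}\le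 C_k ,$$ where the second bound concerns the spatial derivatives of the coefficients $g_{i\bar j}$. Let $f$ be a smooth real-valued function on $\mathbb C^2\times(-\infty,0]$ such that $$\frac{\partial f}{\partial t}=\Delta_{g_t}f,\qquad \sup_{\mathbb C^2\times(-\infty,0]}|f|<\infty ,$$ where $\Delta_{g}f=g^{\bar j i}\partial_i\partial_{\bar j}f$ is the Chern Laplacian. Then $f$ is constant on $\mathbb C^2\times(-\infty,0]$. -/

import Mathlib

open Complex Set
open scoped ContDiff ComplexOrder

noncomputable section

namespace HermitianFlow

/-- The complex manifold `ℂⁿ`, with its Euclidean norm. -/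
abbrev Cn (n : ℕ) : Type := EuclideanSpace ℂ (Fin n)

variable {n : ℕ}

/-- The Wirtinger derivative `∂_k u = ∂u/∂z^k = (∂u/∂x^k - i ∂u/∂y^k) / 2`. -/
def dz (k : Fin n) (u : Cn n → ℂ) (z : Cn n) : ℂ :=
  (fderiv ℝ u z (EuclideanSpace.single k 1) - I * fderiv ℝ u z (EuclideanSpace.single k I)) / 2

/-- The Wirtinger derivative `∂_k̄ u = ∂u/∂z̄^k = (∂u/∂x^k + i ∂u/∂y^k) / 2`. -/
def dzbar (k : Fin n) (u : Cn n → ℂ) (z : Cn n) : ℂ :=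
  (fderiv ℝ u z (EuclideanSpace.single k 1) + I * fderiv ℝ u z (EuclideanSpace.single k I)) / 2

/-- A field of matrices on `ℂⁿ`. It stands for a Hermitian metric `g`, with `g z i j = g_{i j̄}(z)`,
or for a `(1,1)`-form `ψ = ∑ ψ_{i j̄} dz^i ∧ dz̄^j`, with `ψ z i j = ψ_{i j̄}(z)`. -/
abbrev MatrixField (n : ℕ) : Type := Cn n → Matrix (Fin n) (Fin n) ℂ

/-- The coefficients of a `(1,0)`-form `∑ γ_i dz^i` or of a `(0,1)`-form `∑ β_j̄ dz̄^j`. -/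
abbrev CovectorField (n : ℕ) : Type := Cn n → Fin n → ℂ

/-- The inverse metric `g^{j̄ i}`, characterized by `∑_j g^{j̄ i} g_{k j̄} = δ_k^i`. -/
def metricInv (g : MatrixField n) (z : Cn n) (j i : Fin n) : ℂ := (g z)⁻¹ j i

/-- The Kähler form `ω = (i/2) ∑ g_{i j̄} dz^i ∧ dz̄^j`. -/
def kahlerForm (g : MatrixField n) : MatrixField n :=
  fun z => Matrix.of fun i j => I / 2 * g z i j

/-- `∂β` for a `(0,1)`-form `β`: `(∂β)_{i j̄} = ∂_i β_j̄`. -/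
def del (β : CovectorField n) : MatrixField n :=
  fun z => Matrix.of fun i j => dz i (fun w => β w j) z

/-- `∂̄γ` for a `(1,0)`-form `γ`: since `dz̄^j ∧ dz^i = - dz^i ∧ dz̄^j`, one has
`(∂̄γ)_{i j̄} = - ∂_j̄ γ_i`. -/
def delbar (γ : CovectorField n) : MatrixField n :=
  fun z => Matrix.of fun i j => -dzbar j (fun w => γ w i) z

/-- The `(1,1)`-form `∂∂̄u` for a function `u`: `(∂∂̄u)_{i j̄} = ∂_i ∂_j̄ u`. -/
def delDelbar (u : Cn n → ℂ) : MatrixField n :=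
  fun z => Matrix.of fun i j => dz i (dzbar j u) z

/-- The coefficients with both indices raised, multiplied by the volume density `det g`:
`det g ∑_{i,k} g^{j̄ i} g^{k̄ l} ψ_{i k̄}`. -/
def raisedDensity (g ψ : MatrixField n) (j l : Fin n) (z : Cn n) : ℂ :=
  (g z).det * ∑ i, ∑ k, metricInv g z j i * metricInv g z k l * ψ z i k

/-- `∂^*_g ψ` for a `(1,1)`-form `ψ`: the `(0,1)`-form
`(∂^*ψ)_m̄ = - (det g)⁻¹ ∑_{l,j} g_{l m̄} ∂_j̄ (det g ∑_{i,k} g^{j̄ i} g^{k̄ l} ψ_{i k̄})`.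
It is the formal `L²(det g)` adjoint of `∂` on `(0,1)`-forms, that is
`∫ ⟨ψ, ∂β⟩ det g = ∫ ⟨∂^*ψ, β⟩ det g` for test forms `β`, for the pairings
`⟨ψ, φ⟩ = g^{j̄ i} g^{k̄ l} ψ_{i k̄} conj(φ_{j l̄})` and
`⟨α, β⟩ = g^{m̄ l} α_m̄ conj(β_l̄)`: integrate by parts in `∂_j̄`. -/
def delStar (g ψ : MatrixField n) : CovectorField n :=
  fun z m => -((g z).det)⁻¹ * ∑ l, ∑ j, g z l m * dzbar j (raisedDensity g ψ j l) z

/-- `∂̄^*_g ψ` for a `(1,1)`-form `ψ`: the `(1,0)`-form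
`(∂̄^*ψ)_m = (det g)⁻¹ ∑_{j,l} g_{m j̄} ∂_l (det g ∑_{i,k} g^{j̄ i} g^{k̄ l} ψ_{i k̄})`.
It is the formal `L²(det g)` adjoint of `∂̄` on `(1,0)`-forms, for the same pairing of
`(1,1)`-forms and `⟨α, γ⟩ = g^{j̄ i} α_i conj(γ_j)`; the sign is that of `delbar`. -/
def delbarStar (g ψ : MatrixField n) : CovectorField n :=
  fun z m => ((g z).det)⁻¹ * ∑ j, ∑ l, g z m j * dz l (raisedDensity g ψ j l) z

/-- The function `log det g`. -/
def logDet (g : MatrixField n) (z : Cn n) : ℂ := ((Real.log (g z).det.re : ℝ) : ℂ)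

/-- `P(ω) = - ∂∂^*_ω ω - ∂̄∂̄^*_ω ω - (i/2) ∂∂̄ log det g`. -/
def pluriclosedOperator (g : MatrixField n) : MatrixField n :=
  fun z => -del (delStar g (kahlerForm g)) z - delbar (delbarStar g (kahlerForm g)) z
    - (I / 2) • delDelbar (logDet g) z

/-- `∂∂̄ω = 0`. The coefficient of `dz^k ∧ dz̄^l ∧ dz^i ∧ dz̄^j` in `∂∂̄ω`, skew-symmetrized
in `i, k` and in `j, l`, vanishes. -/
def IsPluriclosed (g : MatrixField n) : Prop :=
  ∀ (z : Cn n) (i j k l : Fin n),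
    delDelbar (fun w => kahlerForm g w i j) z k l - delDelbar (fun w => kahlerForm g w k j) z i l
      - delDelbar (fun w => kahlerForm g w i l) z k j
      + delDelbar (fun w => kahlerForm g w k l) z i j = 0

/-- A smooth solution `g_t` of the pluriclosed flow `∂ω/∂t = - P(ω)` on `ℂⁿ × (-∞, 0]`, through
pluriclosed Hermitian metrics. The values `g t` with `t > 0` play no role; at `t = 0` the time
derivative is one-sided. -/
structure IsAncientPluriclosedFlow (g : ℝ → MatrixField n) : Prop where
  smooth : ∀ i j : Fin n,
    ContDiffOn ℝ ∞ (fun p : ℝ × Cn n => g p.1 p.2 i j) (Iic (0 : ℝ) ×ˢ (univ : Set (Cn n)))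
  posDef : ∀ t ≤ 0, ∀ z, (g t z).PosDef
  pluriclosed : ∀ t ≤ 0, IsPluriclosed (g t)
  flow : ∀ t ≤ 0, ∀ (z : Cn n) (i j : Fin n),
    HasDerivWithinAt (fun s => kahlerForm (g s) z i j) (-pluriclosedOperator (g t) z i j)
      (Iic (0 : ℝ)) t

/-- `A⁻¹ g_E ≤ g_t ≤ A g_E` on `ℂⁿ × (-∞, 0]`, as Hermitian forms, where `(g_E)_{i j̄} = δ_{ij}`. -/
def UniformlyEuclidean (A : ℝ) (g : ℝ → MatrixField n) : Prop :=
  ∀ t ≤ 0, ∀ z, (g t z - A⁻¹ • (1 : Matrix (Fin n) (Fin n) ℂ)).PosSemidef ∧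
    (A • (1 : Matrix (Fin n) (Fin n) ℂ) - g t z).PosSemidef

/-- `|g_t|_{C^k} ≤ C_k` on `ℂⁿ × (-∞, 0]` for every `k`: all spatial derivatives of the metric
coefficients are bounded uniformly in space and time. -/
def UniformCkBounds (g : ℝ → MatrixField n) : Prop :=
  ∀ k : ℕ, ∃ C : ℝ, ∀ t ≤ 0, ∀ (z : Cn n) (i j : Fin n),
    ‖iteratedFDeriv ℝ k (fun w => g t w i j) z‖ ≤ C

/-- The Chern Laplacian on functions, `Δu = g^{j̄ i} ∇_i ∇_j̄ u = g^{j̄ i} ∂_i ∂_j̄ u` (the Chern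
connection has no coefficients of mixed type). -/
def chernLaplacian (g : MatrixField n) (u : Cn n → ℂ) (z : Cn n) : ℂ :=
  ∑ i, ∑ j, metricInv g z j i * dz i (dzbar j u) z

end HermitianFlow

end

open Complex Set
open scoped ContDiff ComplexOrder

noncomputable section

namespace HermitianFlow

variable {n : ℕ}

/-! ### Wirtinger calculus -/

/-! The proof is a Bernstein gradient estimate over arbitrarily long time intervals. For a
pluriclosed metric the flow takes the form `∂_t g = Δg - tr_g(∂g · g⁻¹ · ∂̄g) + Q`, with `Q` a
nonnegative quadratic expression in the torsion (`neg_pluriclosedOperator`). In the evolution of `u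
= |∂f|²_g`, the second derivatives of the metric coming from `∂_t g⁻¹` and from `Δ g⁻¹` cancel. What
remains of `(∂_t - Δ)u` is minus two squares: that of the `(2,0)` Chern Hessian of `f`, and that of
the mixed Hessian `∂∂̄f` corrected by the torsion contracted with the gradient. The term `Q` is
exactly what completes the second square (`torsion_square`, `evolution_algebra`). Hence `u` is a
subsolution of the heat equation, with no lower-order term (`exists_hasDerivAt_gradSq`).

Since `(∂_t - Δ)f² = -2u`, the quantity `τu + f²`, with `τ` the time elapsed since `t - T`,
satisfies `(∂_t - Δ)(τu + f²) ≤ -u`. To apply the maximum principle on the noncompact space, `u` is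
multiplied by `ψ²` with `ψ = 1 - |z|²/R²`. The uniform equivalence with the Euclidean metric makes
the cutoff errors of order `T/R²`, and for large `R` the good term `-u` absorbs them
(`conditions_of_isLocalMax`, `bernstein_contradiction`). The outcome is `T u ≤ 4(B² + 1)` when `|f|
≤ B`, with a right-hand side independent of `T` (`gradSq_le`).

As the solution is ancient, `T` is arbitrary, so `u = 0` for negative times. Then `f` depends on
time only, the heat equation makes it constant in time, and continuity reaches `t = 0`. -/

/-- The operator `(∂_{x^k} + c ∂_{y^k}) / 2`: it is `∂_k` for `c = -i` and `∂_k̄` for `c = i`. -/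
def wirtinger (c : ℂ) (k : Fin n) (u : Cn n → ℂ) (z : Cn n) : ℂ :=
  (fderiv ℝ u z (EuclideanSpace.single k 1) + c * fderiv ℝ u z (EuclideanSpace.single k I)) / 2

theorem dz_eq_wirtinger (k : Fin n) : (dz k : (Cn n → ℂ) → Cn n → ℂ) = wirtinger (-I) k := by
  funext u z; simp only [dz, wirtinger]; ring

theorem dzbar_eq_wirtinger (k : Fin n) :
    (dzbar k : (Cn n → ℂ) → Cn n → ℂ) = wirtinger I k := rfl

theorem contDiff_wirtinger (c : ℂ) (k : Fin n) {u : Cn n → ℂ} (hu : ContDiff ℝ ∞ u) :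
    ContDiff ℝ ∞ (wirtinger c k u) := by
  have h : ContDiff ℝ ∞ (fderiv ℝ u) := hu.fderiv_right (by simp)
  have h1 := h.clm_apply (contDiff_const (c := (EuclideanSpace.single k (1 : ℂ) : Cn n)))
  have h2 := h.clm_apply (contDiff_const (c := (EuclideanSpace.single k I : Cn n)))
  exact (h1.add (contDiff_const.mul h2)).div_const 2

theorem ContDiff.differentiableAt_infty {E F : Type*} [NormedAddCommGroup E] [NormedSpace ℝ E]
    [NormedAddCommGroup F] [NormedSpace ℝ F] {u : E → F} (hu : ContDiff ℝ ∞ u) (z : E) :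
    DifferentiableAt ℝ u z := hu.differentiable (by simp) z

theorem wirtinger_const (c : ℂ) (k : Fin n) (a : ℂ) : wirtinger c k (fun _ => a) = 0 := by
  funext z; simp [wirtinger]

theorem wirtinger_add (c : ℂ) (k : Fin n) {u v : Cn n → ℂ} {z : Cn n}
    (hu : DifferentiableAt ℝ u z) (hv : DifferentiableAt ℝ v z) :
    wirtinger c k (fun w => u w + v w) z = wirtinger c k u z + wirtinger c k v z := by
  simp only [wirtinger, fderiv_fun_add hu hv, add_apply]; ring

theorem wirtinger_mul (c : ℂ) (k : Fin n) {u v : Cn n → ℂ} {z : Cn n}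
    (hu : DifferentiableAt ℝ u z) (hv : DifferentiableAt ℝ v z) :
    wirtinger c k (fun w => u w * v w) z
      = wirtinger c k u z * v z + u z * wirtinger c k v z := by
  simp only [wirtinger, fderiv_fun_mul hu hv, add_apply,
    smul_apply, smul_eq_mul]; ring

theorem wirtinger_const_mul (c : ℂ) (k : Fin n) (a : ℂ) {u : Cn n → ℂ} {z : Cn n}
    (hu : DifferentiableAt ℝ u z) :
    wirtinger c k (fun w => a * u w) z = a * wirtinger c k u z := by
  rw [wirtinger_mul c k (differentiableAt_const a) hu, wirtinger_const]; simp

theorem wirtinger_sum (c : ℂ) (k : Fin n) {ι : Type*} (s : Finset ι) {u : ι → Cn n → ℂ}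
    {z : Cn n} (hu : ∀ i ∈ s, DifferentiableAt ℝ (u i) z) :
    wirtinger c k (fun w => ∑ i ∈ s, u i w) z = ∑ i ∈ s, wirtinger c k (u i) z := by
  simp only [wirtinger, fderiv_fun_sum hu, sum_apply]
  rw [Finset.mul_sum, ← Finset.sum_add_distrib, Finset.sum_div]

theorem fderiv_star_apply {E : Type*} [NormedAddCommGroup E] [NormedSpace ℝ E] {u : E → ℂ}
    {z : E} (e : E) (hu : DifferentiableAt ℝ u z) :
    fderiv ℝ (fun w => star (u w)) z e = star (fderiv ℝ u z e) := by
  have h := (conjCLE.toContinuousLinearMap.hasFDerivAt (x := u z)).comp z hu.hasFDerivAt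
  have h' : HasFDerivAt (fun w => star (u w))
    ((conjCLE : ℂ →L[ℝ] ℂ).comp (fderiv ℝ u z)) z := h
  rw [h'.fderiv]; simp

theorem wirtinger_star (c : ℂ) (k : Fin n) {u : Cn n → ℂ} {z : Cn n}
    (hu : DifferentiableAt ℝ u z) :
    wirtinger c k (fun w => star (u w)) z = star (wirtinger (star c) k u z) := by
  simp only [wirtinger, fderiv_star_apply _ hu]
  simp

theorem fderiv_fderiv_apply {E F : Type*} [NormedAddCommGroup E] [NormedSpace ℝ E]
    [NormedAddCommGroup F] [NormedSpace ℝ F] {u : E → F} {z : E}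
    (hu : ContDiffAt ℝ ∞ u z) (e e' : E) :
    fderiv ℝ (fun w => fderiv ℝ u w e') z e = fderiv ℝ (fderiv ℝ u) z e e' := by
  have h : DifferentiableAt ℝ (fderiv ℝ u) z :=
    (hu.fderiv_right (m := ∞) (by simp)).differentiableAt (by simp)
  rw [fderiv_clm_apply h (differentiableAt_const e')]; simp

theorem fderiv_fderiv_comm {E F : Type*} [NormedAddCommGroup E] [NormedSpace ℝ E]
    [NormedAddCommGroup F] [NormedSpace ℝ F] {u : E → F} {z : E}
    (hu : ContDiffAt ℝ ∞ u z) (e e' : E) :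
    fderiv ℝ (fderiv ℝ u) z e e' = fderiv ℝ (fderiv ℝ u) z e' e :=
  hu.isSymmSndFDerivAt (by simpa using WithTop.coe_le_coe.2 (le_top (a := (2 : ℕ∞)))) e e'

theorem fderiv_wirtinger (c : ℂ) (k : Fin n) {u : Cn n → ℂ} (hu : ContDiff ℝ ∞ u) (z e : Cn n) :
    fderiv ℝ (wirtinger c k u) z e
      = (fderiv ℝ (fderiv ℝ u) z e (EuclideanSpace.single k 1)
        + c * fderiv ℝ (fderiv ℝ u) z e (EuclideanSpace.single k I)) / 2 := by
  have h : ContDiff ℝ ∞ (fderiv ℝ u) := hu.fderiv_right (by simp)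
  have h1 : ∀ e', DifferentiableAt ℝ (fun w => fderiv ℝ u w e') z := fun e' =>
    ContDiff.differentiableAt_infty (h.clm_apply contDiff_const) z
  rw [← fderiv_fderiv_apply hu.contDiffAt, ← fderiv_fderiv_apply hu.contDiffAt]
  have : wirtinger c k u = fun w => (2 : ℂ)⁻¹ * (fderiv ℝ u w (EuclideanSpace.single k 1)
      + c * fderiv ℝ u w (EuclideanSpace.single k I)) := by
    funext w; simp only [wirtinger]; ring
  rw [this, fderiv_const_mul ((h1 _).fun_add ((h1 _).const_mul c)), smul_apply,
    fderiv_fun_add (h1 _) ((h1 _).const_mul c), fderiv_const_mul (h1 _),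
    add_apply, smul_apply, smul_eq_mul, smul_eq_mul]
  ring

/-- Both operators have constant coefficients, so this is the symmetry of the real Hessian. Keeping
`c` and `c'` free covers `∂∂`, `∂∂̄` and `∂̄∂̄` at once. -/
theorem wirtinger_comm (c c' : ℂ) (k l : Fin n) {u : Cn n → ℂ} (hu : ContDiff ℝ ∞ u) :
    wirtinger c k (wirtinger c' l u) = wirtinger c' l (wirtinger c k u) := by
  funext z
  rw [wirtinger, wirtinger]
  simp only [fderiv_wirtinger _ _ hu]
  rw [fderiv_fderiv_comm hu.contDiffAt (EuclideanSpace.single l 1),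
    fderiv_fderiv_comm hu.contDiffAt (EuclideanSpace.single l I),
    fderiv_fderiv_comm hu.contDiffAt (EuclideanSpace.single l 1) (EuclideanSpace.single k I),
    fderiv_fderiv_comm hu.contDiffAt (EuclideanSpace.single l I) (EuclideanSpace.single k I)]
  ring

/-! ### Wirtinger calculus for fields of matrices -/

/-- All entries of a field of matrices are smooth. -/
def SmoothMatrix {m p : Type*} (M : Cn n → Matrix m p ℂ) : Prop :=
  ∀ i j, ContDiff ℝ ∞ fun z => M z i j

/-- The entrywise Wirtinger derivative. -/
def mwirtinger {m p : Type*} (c : ℂ) (k : Fin n) (M : Cn n → Matrix m p ℂ) (z : Cn n) :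
    Matrix m p ℂ := Matrix.of fun i j => wirtinger c k (fun w => M w i j) z

section MatrixCalculus

variable {m p q : Type*} [Fintype p] {M : Cn n → Matrix m p ℂ} {N : Cn n → Matrix p q ℂ}

theorem SmoothMatrix.mwirtinger {m p : Type*} {M : Cn n → Matrix m p ℂ} (c : ℂ) (k : Fin n)
    (hM : SmoothMatrix M) : SmoothMatrix (mwirtinger c k M) :=
  fun i j => contDiff_wirtinger c k (hM i j)

theorem SmoothMatrix.mul (hM : SmoothMatrix M) (hN : SmoothMatrix N) :
    SmoothMatrix fun z => M z * N z := by
  intro i j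
  simp only [Matrix.mul_apply]
  exact ContDiff.sum fun a _ => (hM i a).mul (hN a j)

theorem SmoothMatrix.conjTranspose {m p : Type*} {M : Cn n → Matrix m p ℂ} (hM : SmoothMatrix M) :
    SmoothMatrix fun z => (M z).conjTranspose :=
  fun i j => (conjCLE.contDiff (n := ∞)).comp (hM j i)

theorem mwirtinger_mul (c : ℂ) (k : Fin n) (hM : SmoothMatrix M) (hN : SmoothMatrix N)
    (z : Cn n) :
    mwirtinger c k (fun w => M w * N w) z
      = mwirtinger c k M z * N z + M z * mwirtinger c k N z := by
  ext i j
  simp only [mwirtinger, Matrix.of_apply, Matrix.mul_apply, Matrix.add_apply]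
  have h1 := fun a => ContDiff.differentiableAt_infty (hM i a) z
  have h2 := fun a => ContDiff.differentiableAt_infty (hN a j) z
  rw [wirtinger_sum c k _ fun a _ => (h1 a).fun_mul (h2 a), ← Finset.sum_add_distrib]
  exact Finset.sum_congr rfl fun a _ => wirtinger_mul c k (h1 a) (h2 a)

theorem mwirtinger_neg {m p : Type*} {M : Cn n → Matrix m p ℂ} (c : ℂ) (k : Fin n)
    (hM : SmoothMatrix M) (z : Cn n) :
    mwirtinger c k (fun w => -M w) z = -mwirtinger c k M z := by
  ext i j
  have := wirtinger_const_mul c k (-1) (ContDiff.differentiableAt_infty (hM i j) z)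
  simpa [mwirtinger] using this

theorem mwirtinger_add {m p : Type*} {M N : Cn n → Matrix m p ℂ} (c : ℂ) (k : Fin n)
    (hM : SmoothMatrix M) (hN : SmoothMatrix N) (z : Cn n) :
    mwirtinger c k (fun w => M w + N w) z = mwirtinger c k M z + mwirtinger c k N z := by
  ext i j
  exact wirtinger_add c k (ContDiff.differentiableAt_infty (hM i j) z)
    (ContDiff.differentiableAt_infty (hN i j) z)

theorem mwirtinger_conjTranspose {m p : Type*} {M : Cn n → Matrix m p ℂ} (c : ℂ) (k : Fin n)
    (hM : SmoothMatrix M) (z : Cn n) :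
    mwirtinger c k (fun w => (M w).conjTranspose) z
      = (mwirtinger (star c) k M z).conjTranspose := by
  ext i j
  exact wirtinger_star c k (ContDiff.differentiableAt_infty (hM j i) z)

theorem mwirtinger_comm {m p : Type*} {M : Cn n → Matrix m p ℂ} (c c' : ℂ) (k l : Fin n)
    (hM : SmoothMatrix M) :
    mwirtinger c k (mwirtinger c' l M) = mwirtinger c' l (mwirtinger c k M) := by
  funext z; ext i j
  exact congrFun (wirtinger_comm c c' k l (hM i j)) z

end MatrixCalculus

/-! ### Determinants and inverses of fields of matrices. -/

theorem contDiff_det {p : Type*} [Fintype p] [DecidableEq p] {g : Cn n → Matrix p p ℂ}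
    (hg : SmoothMatrix g) : ContDiff ℝ ∞ fun z => (g z).det := by
  simp only [Matrix.det_apply]
  exact ContDiff.sum fun σ _ => (contDiff_prod fun i _ => hg _ _).const_smul _

theorem SmoothMatrix.inv {p : Type*} [Fintype p] [DecidableEq p] {g : Cn n → Matrix p p ℂ}
    (hg : SmoothMatrix g) (hdet : ∀ z, (g z).det ≠ 0) : SmoothMatrix fun z => (g z)⁻¹ := by
  intro i j
  simp only [Matrix.inv_def, Ring.inverse_eq_inv', Matrix.smul_apply, smul_eq_mul,
    Matrix.adjugate_apply]
  refine ((contDiff_det hg).inv hdet).mul (contDiff_det fun a b => ?_)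
  by_cases h : a = j
  · subst h; simp only [Matrix.updateRow_self]; exact contDiff_const
  · simp only [Matrix.updateRow_ne h]; exact hg a b

/-- Differentiate `g⁻¹ g = 1` and multiply by `g⁻¹` on the right. -/
theorem mwirtinger_inv {p : Type*} [Fintype p] [DecidableEq p] {g : Cn n → Matrix p p ℂ}
    (hg : SmoothMatrix g) (hdet : ∀ z, (g z).det ≠ 0) (c : ℂ) (k : Fin n) (z : Cn n) :
    mwirtinger c k (fun w => (g w)⁻¹) z = -((g z)⁻¹ * mwirtinger c k g z * (g z)⁻¹) := by
  have h1 : ∀ w, (g w)⁻¹ * g w = 1 := fun w => Matrix.nonsing_inv_mul _ (hdet w).isUnit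
  have h2 : g z * (g z)⁻¹ = 1 := Matrix.mul_nonsing_inv _ (hdet z).isUnit
  have h := mwirtinger_mul c k (hg.inv hdet) hg z
  have h3 : mwirtinger c k (fun w => (g w)⁻¹ * g w) z = 0 := by
    ext i j
    simp only [mwirtinger, Matrix.of_apply, h1, wirtinger_const]; rfl
  rw [h3] at h
  have h4 := congrArg (· * (g z)⁻¹) h.symm
  simp only [add_mul, Matrix.mul_assoc, h2, Matrix.mul_one, Matrix.zero_mul] at h4
  rw [Matrix.mul_assoc]
  exact eq_neg_of_add_eq_zero_left h4

/-- The second mixed derivatives of the inverse of a field of matrices. -/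
theorem mwirtinger_mwirtinger_inv {p : Type*} [Fintype p] [DecidableEq p]
    {g : Cn n → Matrix p p ℂ}
    (hg : SmoothMatrix g) (hdet : ∀ z, (g z).det ≠ 0) (c c' : ℂ) (k l : Fin n) (z : Cn n) :
    mwirtinger c k (mwirtinger c' l fun w => (g w)⁻¹) z
      = (g z)⁻¹ * mwirtinger c k g z * (g z)⁻¹ * mwirtinger c' l g z * (g z)⁻¹
        + (g z)⁻¹ * mwirtinger c' l g z * (g z)⁻¹ * mwirtinger c k g z * (g z)⁻¹
        - (g z)⁻¹ * mwirtinger c k (mwirtinger c' l g) z * (g z)⁻¹ := by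
  have hH := hg.inv hdet
  have hG := hg.mwirtinger c' l
  rw [funext (mwirtinger_inv hg hdet c' l), mwirtinger_neg c k ((hH.mul hG).mul hH),
    mwirtinger_mul c k (hH.mul hG) hH, mwirtinger_mul c k hH hG, mwirtinger_inv hg hdet]
  noncomm_ring

/-! ### The pluriclosed flow in coordinates -/

open Matrix in
-- Jacobi's formula, checked on the explicit `2 × 2` determinant and adjugate.
theorem wirtinger_det {g : MatrixField 2} (hg : SmoothMatrix g) (hdet : ∀ z, (g z).det ≠ 0)
    (c : ℂ) (k : Fin 2) (z : Cn 2) :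
    wirtinger c k (fun w => (g w).det) z
      = (g z).det * ((g z)⁻¹ * mwirtinger c k g z).trace := by
  have hd := fun i j => ContDiff.differentiableAt_infty (hg i j) z
  have h1 : wirtinger c k (fun w => (g w).det) z
      = ((g z).adjugate * mwirtinger c k g z).trace := by
    have e : (fun w => (g w).det)
        = fun w => g w 0 0 * g w 1 1 + (-1) * (g w 0 1 * g w 1 0) := by
      funext w; rw [det_fin_two]; ring
    rw [e, wirtinger_add c k ((hd _ _).fun_mul (hd _ _))
        (((hd _ _).fun_mul (hd _ _)).const_mul _),
      wirtinger_const_mul c k _ ((hd _ _).fun_mul (hd _ _)), wirtinger_mul c k (hd _ _) (hd _ _),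
      wirtinger_mul c k (hd _ _) (hd _ _)]
    rw [adjugate_fin_two, trace_fin_two, mul_apply, mul_apply]
    simp only [mwirtinger, Fin.sum_univ_two, of_apply, cons_val_zero, cons_val_one, cons_val']
    ring
  rw [h1, Matrix.inv_def, Ring.inverse_eq_inv', smul_mul, trace_smul, smul_eq_mul, ← mul_assoc,
    mul_inv_cancel₀ (hdet z), one_mul]

theorem wirtinger_log_re {u : Cn n → ℂ} (hu : ContDiff ℝ ∞ u) (hpos : ∀ z, 0 < u z) (c : ℂ)
    (k : Fin n) (z : Cn n) :
    wirtinger c k (fun w => ((Real.log (u w).re : ℝ) : ℂ)) z = (u z)⁻¹ * wirtinger c k u z := by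
  have hre : ∀ w, 0 < (u w).re := fun w => (Complex.lt_def.1 (hpos w)).1
  have him : ∀ w, (u w) = ((u w).re : ℂ) := fun w =>
    Complex.ext rfl (by simpa using (Complex.lt_def.1 (hpos w)).2.symm)
  have hr : DifferentiableAt ℝ (fun w => (u w).re) z :=
    (reCLM.contDiff.comp hu).differentiable (n := ∞) (by simp) z
  have h1 := (hr.hasFDerivAt.log (hre z).ne')
  have h2 := ofRealCLM.hasFDerivAt.comp z h1
  have h2' : HasFDerivAt (fun w => ((Real.log (u w).re : ℝ) : ℂ)) _ z := h2
  have h3 := ofRealCLM.hasFDerivAt.comp z hr.hasFDerivAt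
  have h3' : HasFDerivAt u _ z := h3.congr_of_eventuallyEq (Filter.Eventually.of_forall him)
  simp only [wirtinger, h2'.fderiv, h3'.fderiv]
  conv_rhs => rw [him z]
  simp
  ring

section

variable {g : MatrixField 2}

theorem wirtinger_logDet (hg : SmoothMatrix g) (hpos : ∀ z, (g z).PosDef) (c : ℂ) (k : Fin 2)
    (z : Cn 2) :
    wirtinger c k (logDet g) z = ((g z)⁻¹ * mwirtinger c k g z).trace := by
  have hd : ∀ z, 0 < (g z).det := fun z => (hpos z).det_pos
  have := wirtinger_log_re (contDiff_det hg) hd c k z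
  rw [wirtinger_det hg (fun z => (hd z).ne'), inv_mul_cancel_left₀ (hd z).ne'] at this
  exact this

/-- Raising both indices of the metric gives its inverse, so the adjoints applied to `ω` involve
only first derivatives of `det g · g⁻¹`. -/
theorem raisedDensity_kahlerForm (hdet : ∀ z, (g z).det ≠ 0) (j l : Fin 2) :
    raisedDensity g (kahlerForm g) j l = fun z => I / 2 * ((g z).det * (g z)⁻¹ j l) := by
  funext z
  have h1 : (g z)⁻¹ * g z = 1 := Matrix.nonsing_inv_mul _ (hdet z).isUnit
  have h2 : ((g z)⁻¹ * g z * (g z)⁻¹) j l = (g z)⁻¹ j l := by rw [h1, one_mul]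
  rw [← h2]
  simp only [raisedDensity, kahlerForm, metricInv, Matrix.mul_apply, Matrix.of_apply,
    Fin.sum_univ_two]
  ring

theorem wirtinger_raisedDensity (hg : SmoothMatrix g) (hdet : ∀ z, (g z).det ≠ 0) (c : ℂ)
    (k j l : Fin 2) (z : Cn 2) :
    wirtinger c k (raisedDensity g (kahlerForm g) j l) z
      = I / 2 * ((g z).det * (((g z)⁻¹ * mwirtinger c k g z).trace * (g z)⁻¹ j l
        - ((g z)⁻¹ * mwirtinger c k g z * (g z)⁻¹) j l)) := by
  have hd := ContDiff.differentiableAt_infty (contDiff_det hg) z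
  have hi := ContDiff.differentiableAt_infty (hg.inv hdet j l) z
  have h := congrFun (congrFun (mwirtinger_inv hg hdet c k z) j) l
  simp only [mwirtinger, Matrix.of_apply] at h
  rw [raisedDensity_kahlerForm hdet, wirtinger_const_mul c k _ (hd.fun_mul hi),
    wirtinger_mul c k hd hi, wirtinger_det hg hdet, h]
  simp only [Matrix.neg_apply]
  ring_nf
  rfl

/-- Lowering the free index turns `g⁻¹` into the identity, which collapses the derivative of `det g`
to the single index `m`. The bracket is the trace of the conjugate torsion, `g^{j̄ i}(∂_m̄ g_{i j̄}
- ∂_j̄ g_{i m̄})`. -/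
theorem delStar_kahlerForm (hg : SmoothMatrix g) (hdet : ∀ z, (g z).det ≠ 0) (z : Cn 2)
    (m : Fin 2) :
    delStar g (kahlerForm g) z m = -(I / 2) * (((g z)⁻¹ * mwirtinger I m g z).trace
      - ∑ j, ((g z)⁻¹ * mwirtinger I j g z) j m) := by
  have h1 : (g z)⁻¹ * g z = 1 := Matrix.nonsing_inv_mul _ (hdet z).isUnit
  have e1 : ∀ j, ∑ l, (g z)⁻¹ j l * g z l m = (1 : Matrix (Fin 2) (Fin 2) ℂ) j m := fun j => by
    rw [← h1, Matrix.mul_apply]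
  have e2 : ∀ j, ∑ l, ((g z)⁻¹ * mwirtinger I j g z * (g z)⁻¹) j l * g z l m
      = ((g z)⁻¹ * mwirtinger I j g z) j m := fun j => by
    rw [← Matrix.mul_apply, Matrix.mul_assoc _ _ (g z), h1, mul_one]
  have e3 : ((g z)⁻¹ * mwirtinger I m g z).trace = ∑ j, ((g z)⁻¹ * mwirtinger I j g z).trace *
      (1 : Matrix (Fin 2) (Fin 2) ℂ) j m := by simp [Matrix.one_apply]
  rw [e3]
  simp only [← e1, ← e2]
  simp only [delStar, dzbar_eq_wirtinger, wirtinger_raisedDensity hg hdet]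
  have := hdet z
  field_simp
  simp only [Fin.sum_univ_two]
  ring

theorem delbarStar_kahlerForm (hg : SmoothMatrix g) (hdet : ∀ z, (g z).det ≠ 0) (z : Cn 2)
    (m : Fin 2) :
    delbarStar g (kahlerForm g) z m = I / 2 * (((g z)⁻¹ * mwirtinger (-I) m g z).trace
      - ∑ l, (mwirtinger (-I) l g z * (g z)⁻¹) m l) := by
  have h1 : g z * (g z)⁻¹ = 1 := Matrix.mul_nonsing_inv _ (hdet z).isUnit
  have e1 : ∀ l, ∑ j, g z m j * (g z)⁻¹ j l = (1 : Matrix (Fin 2) (Fin 2) ℂ) m l := fun j => by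
    rw [← h1, Matrix.mul_apply]
  have e2 : ∀ l, ∑ j, g z m j * ((g z)⁻¹ * mwirtinger (-I) l g z * (g z)⁻¹) j l
      = (mwirtinger (-I) l g z * (g z)⁻¹) m l := fun j => by
    rw [← Matrix.mul_apply, ← Matrix.mul_assoc, ← Matrix.mul_assoc, h1, one_mul]
  have e3 : ((g z)⁻¹ * mwirtinger (-I) m g z).trace
      = ∑ j, ((g z)⁻¹ * mwirtinger (-I) j g z).trace *
      (1 : Matrix (Fin 2) (Fin 2) ℂ) m j := by simp [Matrix.one_apply]
  rw [e3]
  simp only [← e1, ← e2]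
  simp only [delbarStar, dz_eq_wirtinger, wirtinger_raisedDensity hg hdet]
  have := hdet z
  field_simp
  simp only [Fin.sum_univ_two]
  ring

end

/-! ### The algebra behind the evolution of `|∂f|²` -/

open Matrix in
open scoped MatrixOrder in
-- Write `H = C* C`; by cyclicity the trace is that of `C Z C*`.
theorem trace_mul_nonneg_of_posSemidef {p : Type*} [Fintype p] {H Z : Matrix p p ℂ}
    (hH : H.PosSemidef) (hZ : Z.PosSemidef) : 0 ≤ (H * Z).trace := by
  classical
  obtain ⟨C, rfl⟩ := CStarAlgebra.nonneg_iff_eq_star_mul_self.mp hH.nonneg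
  rw [Matrix.mul_assoc, trace_mul_comm]
  exact (hZ.mul_mul_conjTranspose_same C).trace_nonneg

open Matrix in
-- With the `X k` as columns of a matrix `Y`, the sum is the trace of `H` times the transpose of the
-- Gram matrix `Y* A Y`.
theorem sum_mul_conjTranspose_mul_nonneg {p q : Type*} [Fintype p] [Fintype q]
    {A : Matrix p p ℂ} {H : Matrix q q ℂ} (hA : A.PosSemidef) (hH : H.PosSemidef)
    (X : q → Matrix p (Fin 1) ℂ) : 0 ≤ ∑ k, ∑ l, H l k * ((X l)ᴴ * A * X k) 0 0 := by
  let Y : Matrix p q ℂ := Matrix.of fun i k => X k i 0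
  have h := trace_mul_nonneg_of_posSemidef hH (hA.conjTranspose_mul_mul_same Y).transpose
  convert h using 1
  rw [Finset.sum_comm]
  simp only [trace, diag_apply, mul_apply (M := H), transpose_apply]
  rfl

/-- The torsion `T_i` as a matrix: `(T_i)_{s r̄} = ∂_i g_{s r̄} - ∂_s g_{i r̄}`, if `G_i = ∂_i g`. -/
def torsionMatrix {p : Type*} (G : p → Matrix p p ℂ) (i : p) : Matrix p p ℂ :=
  Matrix.of fun s r => G i s r - G s i r

open Matrix in
/-- Completion of the square for the torsion terms. -/
theorem torsion_square {H D : Matrix (Fin 2) (Fin 2) ℂ} (hH : H.IsHermitian)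
    (G : Fin 2 → Matrix (Fin 2) (Fin 2) ℂ) (W : Matrix (Fin 2) (Fin 1) ℂ)
    (Dc : Fin 2 → Matrix (Fin 2) (Fin 1) ℂ) (hD : D = Matrix.of fun p l => Dc l p 0)
    {N : Matrix (Fin 2) (Fin 2) ℂ} (hN : N = -∑ i, star (W i 0) • torsionMatrix G i) :
    (∑ k, ∑ l, H l k * ((Dc k)ᴴ * H * (G l)ᴴ * W + Wᴴ * G k * H * Dc l
        - (Dc k)ᴴ * H * Dc l) 0 0)
      - (∑ i, star (W i 0) * (H * G i * H * D).trace)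
      - (∑ i, star (H * G i * H * D).trace * W i 0)
      - (∑ i, ∑ j, star (W i 0) *
          (torsionMatrix G i * H * (torsionMatrix G j)ᴴ * H).trace * W j 0)
      = -(H * ((D - Nᴴ) * H * (D - Nᴴ)ᴴ)).trace := by
  have h : ∀ a b, star (H a b) = H b a := fun a b => hH.apply b a
  subst hN hD
  simp only [Fin.sum_univ_two, trace_fin_two, mul_apply, torsionMatrix, of_apply,
    conjTranspose_apply, Matrix.sub_apply, Matrix.neg_apply, Matrix.add_apply, Matrix.smul_apply,
    smul_eq_mul, star_add, star_sub, star_neg, star_mul', star_star, h]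
  ring

open Matrix in
-- The pointwise inequality `(∂_t - Δ)|∂f|² ≤ 0` as matrix algebra. The dictionary is `H = g⁻¹`, `G
-- k = ∂_k g`, `G2 k l = ∂_k ∂_l̄ g`, `W = g⁻¹ ∂f`, `E k = ∂_k ∂f`, `Dc l = ∂_l̄ ∂f`, `V2 k l = ∂_k
-- ∂_l̄ ∂f`, while `Vt` and `gt` are time derivatives. `hVt` is the differentiated heat equation and
-- `hgt` is the flow.
theorem evolution_algebra {H D gt : Matrix (Fin 2) (Fin 2) ℂ} (hH : H.PosSemidef)
    (G : Fin 2 → Matrix (Fin 2) (Fin 2) ℂ) (G2 : Fin 2 → Fin 2 → Matrix (Fin 2) (Fin 2) ℂ)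
    (W Vt : Matrix (Fin 2) (Fin 1) ℂ) (E Dc : Fin 2 → Matrix (Fin 2) (Fin 1) ℂ)
    (V2 : Fin 2 → Fin 2 → Matrix (Fin 2) (Fin 1) ℂ) (hD : D = Matrix.of fun p l => Dc l p 0)
    (hVt : ∀ i, Vt i 0 = (∑ k, ∑ l, H l k * V2 k l i 0) - (H * G i * H * D).trace)
    (hgt : ∀ i j, gt i j = (∑ k, ∑ l, H l k * (G2 k l - G k * H * (G l)ᴴ) i j)
      + (torsionMatrix G i * H * (torsionMatrix G j)ᴴ * H).trace) :
    (Vtᴴ * W - Wᴴ * gt * W + Wᴴ * Vt) 0 0 - ∑ k, ∑ l, H l k * ((V2 l k)ᴴ * W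
      - (E l)ᴴ * H * G k * W + (E l)ᴴ * H * E k - (Dc k)ᴴ * H * (G l)ᴴ * W
      + Wᴴ * (G k * H * (G l)ᴴ + (G l)ᴴ * H * G k - G2 k l) * W - Wᴴ * (G l)ᴴ * H * E k
      + (Dc k)ᴴ * H * Dc l - Wᴴ * G k * H * Dc l + Wᴴ * V2 k l) 0 0 ≤ 0 := by
  have hHH := hH.isHermitian
  have h : ∀ a b, star (H a b) = H b a := fun a b => hHH.apply b a
  obtain ⟨N, hN⟩ : ∃ N, N = -∑ i, star (W i 0) • torsionMatrix G i := ⟨_, rfl⟩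
  have hsq := torsion_square hHH G W Dc hD hN
  have hpos2 := trace_mul_nonneg_of_posSemidef hH (hH.mul_mul_conjTranspose_same (D - Nᴴ))
  -- `E k - G k W` is the Chern covariant derivative `∇_k ∂f`, since the Christoffel symbols are
  -- `∂_k g · g⁻¹`.
  have hpos1 := sum_mul_conjTranspose_mul_nonneg hH hH fun k => E k - G k * W
  have hS : ∀ k l, (V2 l k)ᴴ * W
      - (E l)ᴴ * H * G k * W + (E l)ᴴ * H * E k - (Dc k)ᴴ * H * (G l)ᴴ * W
      + Wᴴ * (G k * H * (G l)ᴴ + (G l)ᴴ * H * G k - G2 k l) * W - Wᴴ * (G l)ᴴ * H * E k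
      + (Dc k)ᴴ * H * Dc l - Wᴴ * G k * H * Dc l + Wᴴ * V2 k l
      = (E l - G l * W)ᴴ * H * (E k - G k * W) + (V2 l k)ᴴ * W + Wᴴ * V2 k l
        - Wᴴ * (G2 k l - G k * H * (G l)ᴴ) * W
        - ((Dc k)ᴴ * H * (G l)ᴴ * W + Wᴴ * G k * H * Dc l - (Dc k)ᴴ * H * Dc l) := by
    intro k l
    simp only [conjTranspose_sub, conjTranspose_mul, Matrix.mul_sub, Matrix.sub_mul,
      Matrix.mul_add, Matrix.add_mul, Matrix.mul_assoc]
    abel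
  have hS' : ∀ k l, ((V2 l k)ᴴ * W
      - (E l)ᴴ * H * G k * W + (E l)ᴴ * H * E k - (Dc k)ᴴ * H * (G l)ᴴ * W
      + Wᴴ * (G k * H * (G l)ᴴ + (G l)ᴴ * H * G k - G2 k l) * W - Wᴴ * (G l)ᴴ * H * E k
      + (Dc k)ᴴ * H * Dc l - Wᴴ * G k * H * Dc l + Wᴴ * V2 k l) 0 0
      = ((E l - G l * W)ᴴ * H * (E k - G k * W)) 0 0 + (∑ i, star (V2 l k i 0) * W i 0)
        + (∑ i, star (W i 0) * V2 k l i 0)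
        - (∑ i, ∑ j, star (W i 0) * (G2 k l - G k * H * (G l)ᴴ) i j * W j 0)
        - ((Dc k)ᴴ * H * (G l)ᴴ * W + Wᴴ * G k * H * Dc l - (Dc k)ᴴ * H * Dc l) 0 0 := by
    intro k l
    rw [hS]
    generalize G2 k l - G k * H * (G l)ᴴ = Z
    generalize (E l - G l * W)ᴴ * H * (E k - G k * W) = Z1
    generalize (Dc k)ᴴ * H * (G l)ᴴ * W + Wᴴ * G k * H * Dc l - (Dc k)ᴴ * H * Dc l = Z2
    simp only [Matrix.sub_apply, Matrix.add_apply, mul_apply, conjTranspose_apply,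
      Fin.sum_univ_two]
    ring
  have key : (Vtᴴ * W - Wᴴ * gt * W + Wᴴ * Vt) 0 0
      = (∑ i, star (Vt i 0) * W i 0) - (∑ i, ∑ j, star (W i 0) * gt i j * W j 0)
        + ∑ i, star (W i 0) * Vt i 0 := by
    simp only [Matrix.sub_apply, Matrix.add_apply, mul_apply, conjTranspose_apply,
      Fin.sum_univ_two]
    ring
  rw [key]
  simp only [hS', hVt, hgt]
  have hfin : ∀ {a b c : ℂ}, 0 ≤ a → 0 ≤ b → c = -a - b → c ≤ 0 := by
    intro a b c ha hb hc
    rw [hc, sub_eq_add_neg]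
    exact add_nonpos (neg_nonpos.2 ha) (neg_nonpos.2 hb)
  refine hfin hpos1 hpos2 ?_
  simp only [Fin.sum_univ_two, star_add, star_sub, star_mul', h] at hsq ⊢
  linear_combination hsq

/-! ### The right-hand side of the flow for a pluriclosed metric. -/

section

open Matrix

variable {g : MatrixField 2}

theorem mwirtinger_I_eq_conjTranspose {p : Type*} {g : Cn n → Matrix p p ℂ}
    (hg : SmoothMatrix g) (hH : ∀ z, (g z).IsHermitian) (k : Fin n) (z : Cn n) :
    mwirtinger I k g z = (mwirtinger (-I) k g z)ᴴ := by
  have h := mwirtinger_conjTranspose I k hg z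
  rwa [funext fun w => (hH w).eq, show star I = -I by simp] at h

theorem delDelbar_kahlerForm (hg : SmoothMatrix g) (z : Cn 2) (i j k l : Fin 2) :
    delDelbar (fun w => kahlerForm g w i j) z k l
      = I / 2 * mwirtinger (-I) k (mwirtinger I l g) z i j := by
  have h1 : wirtinger I l (fun w => I / 2 * g w i j)
      = fun w => I / 2 * wirtinger I l (fun w => g w i j) w := by
    funext w
    exact wirtinger_const_mul I l _ (ContDiff.differentiableAt_infty (hg i j) w)
  simp only [delDelbar, kahlerForm, of_apply, dz_eq_wirtinger, dzbar_eq_wirtinger, h1]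
  exact wirtinger_const_mul (-I) k _
    (ContDiff.differentiableAt_infty (contDiff_wirtinger I l (hg i j)) z)

theorem wirtinger_trace_sub_sum {M : MatrixField 2} {L : Fin 2 → MatrixField 2}
    (hM : SmoothMatrix M) (hL : ∀ a, SmoothMatrix (L a)) (c b : ℂ) (k : Fin 2)
    (p q : Fin 2 → Fin 2) (z : Cn 2) :
    wirtinger c k (fun w => b * ((M w).trace - ∑ a, L a w (p a) (q a))) z
      = b * ((mwirtinger c k M z).trace - ∑ a, mwirtinger c k (L a) z (p a) (q a)) := by
  have dM := fun a => ContDiff.differentiableAt_infty (hM a a) z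
  have dL := fun a => ContDiff.differentiableAt_infty (hL a (p a) (q a)) z
  have e : (fun w => b * ((M w).trace - ∑ a, L a w (p a) (q a)))
      = fun w => b * (M w 0 0 + M w 1 1 + (-1) * (L 0 w (p 0) (q 0) + L 1 w (p 1) (q 1))) := by
    funext w; rw [trace_fin_two, Fin.sum_univ_two]; ring
  rw [e, wirtinger_const_mul c k b (((dM 0).fun_add (dM 1)).fun_add
      (((dL 0).fun_add (dL 1)).const_mul _)),
    wirtinger_add c k ((dM 0).fun_add (dM 1)) (((dL 0).fun_add (dL 1)).const_mul _),
    wirtinger_const_mul c k _ ((dL 0).fun_add (dL 1)), wirtinger_add c k (dM 0) (dM 1),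
    wirtinger_add c k (dL 0) (dL 1), trace_fin_two, Fin.sum_univ_two]
  simp only [mwirtinger, of_apply]
  ring

theorem wirtinger_trace {M : MatrixField 2} (hM : SmoothMatrix M) (c : ℂ) (k : Fin 2)
    (z : Cn 2) : wirtinger c k (fun w => (M w).trace) z = (mwirtinger c k M z).trace :=
  wirtinger_sum c k _ fun a _ => ContDiff.differentiableAt_infty (hM a a) z

/-- The right-hand side of the pluriclosed flow, for a pluriclosed metric:
`Δ g_{i j̄} - g^{l̄ k} (∂_k g · g⁻¹ · ∂_l̄ g)_{i j̄} + Q_{i j̄}`, where `Q` is the square of the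
torsion. -/
theorem neg_pluriclosedOperator (hg : SmoothMatrix g) (hpos : ∀ z, (g z).PosDef)
    (hpl : IsPluriclosed g) (z : Cn 2) (i j : Fin 2) :
    -pluriclosedOperator g z i j = I / 2 * ((∑ k, ∑ l, (g z)⁻¹ l k *
        (mwirtinger (-I) k (mwirtinger I l g) z
          - mwirtinger (-I) k g z * (g z)⁻¹ * (mwirtinger (-I) l g z)ᴴ) i j)
      + (torsionMatrix (fun k => mwirtinger (-I) k g z) i * (g z)⁻¹
        * (torsionMatrix (fun k => mwirtinger (-I) k g z) j)ᴴ * (g z)⁻¹).trace) := by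
  have hdet : ∀ z, (g z).det ≠ 0 := fun z => (hpos z).det_pos.ne'
  have hbar := mwirtinger_I_eq_conjTranspose hg (fun z => (hpos z).isHermitian)
  have hH := hg.inv hdet
  have hinv := fun c k => mwirtinger_inv hg hdet c k z
  have sM : ∀ a, SmoothMatrix fun w => (g w)⁻¹ * mwirtinger I a g w :=
    fun a => hH.mul (hg.mwirtinger I a)
  have sN : ∀ a, SmoothMatrix fun w => (g w)⁻¹ * mwirtinger (-I) a g w :=
    fun a => hH.mul (hg.mwirtinger (-I) a)
  have sL : ∀ a, SmoothMatrix fun w => mwirtinger (-I) a g w * (g w)⁻¹ :=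
    fun a => (hg.mwirtinger (-I) a).mul hH
  have dM : ∀ a, mwirtinger (-I) i (fun w => (g w)⁻¹ * mwirtinger I a g w) z
      = -((g z)⁻¹ * mwirtinger (-I) i g z * (g z)⁻¹) * mwirtinger I a g z
        + (g z)⁻¹ * mwirtinger (-I) i (mwirtinger I a g) z := fun a => by
    rw [mwirtinger_mul _ _ hH (hg.mwirtinger I a), hinv]
  have dN : ∀ a, mwirtinger I j (fun w => (g w)⁻¹ * mwirtinger (-I) a g w) z
      = -((g z)⁻¹ * mwirtinger I j g z * (g z)⁻¹) * mwirtinger (-I) a g z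
        + (g z)⁻¹ * mwirtinger (-I) a (mwirtinger I j g) z := fun a => by
    rw [mwirtinger_mul _ _ hH (hg.mwirtinger (-I) a), hinv, mwirtinger_comm I (-I) j a hg]
  have dL : ∀ a, mwirtinger I j (fun w => mwirtinger (-I) a g w * (g w)⁻¹) z
      = mwirtinger (-I) a (mwirtinger I j g) z * (g z)⁻¹
        + mwirtinger (-I) a g z * -((g z)⁻¹ * mwirtinger I j g z * (g z)⁻¹) := fun a => by
    rw [mwirtinger_mul _ _ (hg.mwirtinger (-I) a) hH, hinv, mwirtinger_comm I (-I) j a hg]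
  have h1 : del (delStar g (kahlerForm g)) z i j
      = -(I / 2) * ((mwirtinger (-I) i (fun w => (g w)⁻¹ * mwirtinger I j g w) z).trace
        - ∑ a, mwirtinger (-I) i (fun w => (g w)⁻¹ * mwirtinger I a g w) z a j) := by
    simp only [del, of_apply, delStar_kahlerForm hg hdet, dz_eq_wirtinger]
    exact wirtinger_trace_sub_sum (sM j) sM (-I) _ i id (fun _ => j) z
  have h2 : delbar (delbarStar g (kahlerForm g)) z i j
      = -(I / 2 * ((mwirtinger I j (fun w => (g w)⁻¹ * mwirtinger (-I) i g w) z).trace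
        - ∑ a, mwirtinger I j (fun w => mwirtinger (-I) a g w * (g w)⁻¹) z i a)) := by
    simp only [delbar, of_apply, delbarStar_kahlerForm hg hdet, dzbar_eq_wirtinger]
    exact congrArg Neg.neg (wirtinger_trace_sub_sum (sN i) sL I _ j (fun _ => i) id z)
  have h3 : delDelbar (logDet g) z i j
      = (mwirtinger (-I) i (fun w => (g w)⁻¹ * mwirtinger I j g w) z).trace := by
    simp only [delDelbar, of_apply, dz_eq_wirtinger, dzbar_eq_wirtinger,
      funext (wirtinger_logDet hg hpos I j)]
    exact wirtinger_trace (sM j) (-I) i z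
  have hp : ∀ k l, mwirtinger (-I) k (mwirtinger I l g) z i j
      - mwirtinger (-I) i (mwirtinger I l g) z k j - mwirtinger (-I) k (mwirtinger I j g) z i l
      + mwirtinger (-I) i (mwirtinger I j g) z k l = 0 := fun k l => by
    have := hpl z i j k l
    simp only [delDelbar_kahlerForm hg] at this
    have hI : (I / 2 : ℂ) ≠ 0 := by simp
    apply mul_left_cancel₀ hI
    linear_combination this
  simp only [pluriclosedOperator, Matrix.sub_apply, Matrix.neg_apply, Matrix.smul_apply,
    smul_eq_mul, h1, h2, h3, dM, dN, dL, ← hbar]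
  have hT : ∀ p q, (torsionMatrix (fun k => mwirtinger (-I) k g z) j)ᴴ p q
      = mwirtinger I j g z p q - mwirtinger I q g z p j := fun p q => by
    simp only [hbar, torsionMatrix, conjTranspose_apply, of_apply, star_sub]
  generalize (torsionMatrix (fun k => mwirtinger (-I) k g z) j)ᴴ = S at hT ⊢
  simp only [trace_fin_two, mul_apply, Fin.sum_univ_two, hT, Matrix.add_apply, Matrix.neg_apply,
    torsionMatrix, of_apply]
  generalize (g z)⁻¹ = H
  -- The pluriclosed identities contracted with `g^{l̄ k}`: they trade the other second derivatives
  -- of the metric for `g^{l̄ k} ∂_k ∂_l̄ g_{i j̄}`, so that only first-order terms remain to be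
  -- matched.
  linear_combination (-(I / 2)) * (H 0 0 * hp 0 0 + H 0 1 * hp 1 0 + H 1 0 * hp 0 1
    + H 1 1 * hp 1 1)

end

/-! ### Evolution of the squared gradient -/

section

open Matrix

theorem mwirtinger_mul₃ {m p q r : Type*} [Fintype p] [Fintype q] {A : Cn n → Matrix m p ℂ}
    {B : Cn n → Matrix p q ℂ} {C : Cn n → Matrix q r ℂ} (hA : SmoothMatrix A)
    (hB : SmoothMatrix B) (hC : SmoothMatrix C) (c : ℂ) (k : Fin n) (z : Cn n) :
    mwirtinger c k (fun w => A w * B w * C w) z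
      = mwirtinger c k A z * B z * C z + A z * mwirtinger c k B z * C z
        + A z * B z * mwirtinger c k C z := by
  rw [mwirtinger_mul c k (hA.mul hB) hC, mwirtinger_mul c k hA hB, Matrix.add_mul]

theorem SmoothMatrix.add {m p : Type*} {M N : Cn n → Matrix m p ℂ} (hM : SmoothMatrix M)
    (hN : SmoothMatrix N) : SmoothMatrix fun z => M z + N z :=
  fun i j => (hM i j).add (hN i j)

theorem mwirtinger_mwirtinger_mul₃ {m p q r : Type*} [Fintype p] [Fintype q]
    {A : Cn n → Matrix m p ℂ} {B : Cn n → Matrix p q ℂ} {C : Cn n → Matrix q r ℂ}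
    (hA : SmoothMatrix A) (hB : SmoothMatrix B) (hC : SmoothMatrix C) (c c' : ℂ) (k l : Fin n)
    (z : Cn n) :
    mwirtinger c k (mwirtinger c' l fun w => A w * B w * C w) z
      = mwirtinger c k (mwirtinger c' l A) z * B z * C z
        + mwirtinger c' l A z * mwirtinger c k B z * C z
        + mwirtinger c' l A z * B z * mwirtinger c k C z
        + (mwirtinger c k A z * mwirtinger c' l B z * C z
        + A z * mwirtinger c k (mwirtinger c' l B) z * C z
        + A z * mwirtinger c' l B z * mwirtinger c k C z)
        + (mwirtinger c k A z * B z * mwirtinger c' l C z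
        + A z * mwirtinger c k B z * mwirtinger c' l C z
        + A z * B z * mwirtinger c k (mwirtinger c' l C) z) := by
  have hA' := hA.mwirtinger c' l
  have hB' := hB.mwirtinger c' l
  have hC' := hC.mwirtinger c' l
  rw [funext (mwirtinger_mul₃ hA hB hC c' l),
    mwirtinger_add c k (((hA'.mul hB).mul hC).add ((hA.mul hB').mul hC)) ((hA.mul hB).mul hC'),
    mwirtinger_add c k ((hA'.mul hB).mul hC) ((hA.mul hB').mul hC),
    mwirtinger_mul₃ hA' hB hC, mwirtinger_mul₃ hA hB' hC, mwirtinger_mul₃ hA hB hC']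

/-- The `(1,0)`-gradient `∂f` as a column. -/
def gradCol (f : Cn n → ℂ) (z : Cn n) : Matrix (Fin n) (Fin 1) ℂ :=
  Matrix.of fun i _ => wirtinger (-I) i f z

/-- The squared norm `|∂f|²_g` of the gradient of a real function `f`. -/
def gradSq (g : MatrixField n) (f : Cn n → ℂ) (z : Cn n) : ℂ :=
  ((gradCol f z)ᴴ * (g z)⁻¹ * gradCol f z) 0 0

theorem smoothMatrix_gradCol {f : Cn n → ℂ} (hf : ContDiff ℝ ∞ f) : SmoothMatrix (gradCol f) :=
  fun i _ => contDiff_wirtinger (-I) i hf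

/-- The product rule for `(∂f)* g⁻¹ ∂f`, with derivatives of `g⁻¹` expressed by those of `g` and
with `∂_l̄ g = (∂_l g)*` because `g` is Hermitian. The terms are arranged to match
`evolution_algebra`. -/
theorem mwirtinger_gradSq {g : MatrixField n} (hg : SmoothMatrix g)
    (hpos : ∀ z, (g z).PosDef) {f : Cn n → ℂ} (hf : ContDiff ℝ ∞ f) (k l : Fin n) (z : Cn n)
    {H : Matrix (Fin n) (Fin n) ℂ} (hH : H = (g z)⁻¹) {W : Matrix (Fin n) (Fin 1) ℂ}
    (hW : W = H * gradCol f z) :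
    mwirtinger (-I) k (mwirtinger I l fun w => (gradCol f w)ᴴ * (g w)⁻¹ * gradCol f w) z
      = (mwirtinger (-I) l (mwirtinger I k (gradCol f)) z)ᴴ * W
      - (mwirtinger (-I) l (gradCol f) z)ᴴ * H * mwirtinger (-I) k g z * W
      + (mwirtinger (-I) l (gradCol f) z)ᴴ * H * mwirtinger (-I) k (gradCol f) z
      - (mwirtinger I k (gradCol f) z)ᴴ * H * (mwirtinger (-I) l g z)ᴴ * W
      + Wᴴ * (mwirtinger (-I) k g z * H * (mwirtinger (-I) l g z)ᴴ
        + (mwirtinger (-I) l g z)ᴴ * H * mwirtinger (-I) k g z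
        - mwirtinger (-I) k (mwirtinger I l g) z) * W
      - Wᴴ * (mwirtinger (-I) l g z)ᴴ * H * mwirtinger (-I) k (gradCol f) z
      + (mwirtinger I k (gradCol f) z)ᴴ * H * mwirtinger I l (gradCol f) z
      - Wᴴ * mwirtinger (-I) k g z * H * mwirtinger I l (gradCol f) z
      + Wᴴ * mwirtinger (-I) k (mwirtinger I l (gradCol f)) z := by
  have hV := smoothMatrix_gradCol hf
  have hdet : ∀ z, (g z).det ≠ 0 := fun z => (hpos z).det_pos.ne'
  have hbar := mwirtinger_I_eq_conjTranspose hg (fun z => (hpos z).isHermitian)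
  have hHH : Hᴴ = H := by rw [hH]; exact (hpos z).isHermitian.inv.eq
  have hs : star I = -I := by simp
  have hs' : star (-I) = I := by simp
  have e1 : ∀ w, mwirtinger I l (fun w => (gradCol f w)ᴴ) w
      = (mwirtinger (-I) l (gradCol f) w)ᴴ := fun w => by
    rw [mwirtinger_conjTranspose I l hV, hs]
  rw [mwirtinger_mwirtinger_mul₃ hV.conjTranspose (hg.inv hdet) hV, funext e1,
    mwirtinger_mwirtinger_inv hg hdet,
    mwirtinger_conjTranspose (-I) k (hV.mwirtinger (-I) l),
    mwirtinger_conjTranspose (-I) k hV, hs', mwirtinger_comm I (-I) k l hV,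
    mwirtinger_inv hg hdet, mwirtinger_inv hg hdet, hbar, ← hH, hW]
  simp only [conjTranspose_mul, hHH, Matrix.mul_add, Matrix.add_mul, Matrix.mul_sub,
    Matrix.sub_mul, Matrix.mul_assoc, Matrix.mul_neg, Matrix.neg_mul]
  abel

theorem chernLaplacian_eq (g : MatrixField n) (u : Cn n → ℂ) (z : Cn n) :
    chernLaplacian g u z
      = ∑ k, ∑ l, (g z)⁻¹ l k * wirtinger (-I) k (wirtinger I l u) z := by
  simp only [chernLaplacian, metricInv, dz_eq_wirtinger, dzbar_eq_wirtinger]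

/-- Commuting `∂_i` past the second derivatives gives the Laplacian of `∂_i f` componentwise; the
trace term comes from `∂_i g⁻¹`. This supplies the hypothesis `hVt` of `evolution_algebra`. -/
theorem wirtinger_chernLaplacian {g : MatrixField n} (hg : SmoothMatrix g)
    (hdet : ∀ z, (g z).det ≠ 0) {f : Cn n → ℂ} (hf : ContDiff ℝ ∞ f) (i : Fin n) (z : Cn n) :
    wirtinger (-I) i (chernLaplacian g f) z
      = (∑ k, ∑ l, (g z)⁻¹ l k * mwirtinger (-I) k (mwirtinger I l (gradCol f)) z i 0)
        - ((g z)⁻¹ * mwirtinger (-I) i g z * (g z)⁻¹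
          * Matrix.of fun p l => mwirtinger I l (gradCol f) z p 0).trace := by
  have hD := fun k l => ContDiff.differentiableAt_infty
    (contDiff_wirtinger (-I) k (contDiff_wirtinger I l hf)) z
  have hI := fun k l => ContDiff.differentiableAt_infty (hg.inv hdet l k) z
  rw [funext (chernLaplacian_eq g f), wirtinger_sum _ _ _ fun k _ =>
    DifferentiableAt.fun_sum fun l _ => (hI k l).fun_mul (hD k l)]
  simp only [wirtinger_sum _ _ _ fun l _ => (hI _ l).fun_mul (hD _ l)]
  simp only [wirtinger_mul _ _ (hI _ _) (hD _ _)]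
  have e1 : ∀ k l, wirtinger (-I) i (fun w => (g w)⁻¹ l k) z
      = -((g z)⁻¹ * mwirtinger (-I) i g z * (g z)⁻¹) l k := fun k l =>
    congrFun (congrFun (mwirtinger_inv hg hdet (-I) i z) l) k
  have e2 : ∀ k l, wirtinger (-I) i (wirtinger (-I) k (wirtinger I l f)) z
      = mwirtinger (-I) k (mwirtinger I l (gradCol f)) z i 0 := fun k l => by
    rw [wirtinger_comm (-I) (-I) i k (contDiff_wirtinger I l hf), wirtinger_comm (-I) I i l hf]
    rfl
  have e3 : ∀ k l, wirtinger (-I) k (wirtinger I l f) z = mwirtinger I l (gradCol f) z k 0 :=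
    fun k l => by rw [wirtinger_comm (-I) I k l hf]; rfl
  simp only [e1, e2, e3, Finset.sum_add_distrib]
  rw [add_comm, sub_eq_add_neg, trace_mul_comm]
  congr 1
  generalize (g z)⁻¹ * mwirtinger (-I) i g z * (g z)⁻¹ = Z
  simp only [trace, diag_apply, Matrix.mul_apply, of_apply, neg_mul,
    Finset.sum_neg_distrib]
  simp only [mul_comm]

end

/-! ### Derivatives in time -/

section

open Matrix Filter Topology

/-- Entrywise derivative of a curve of matrices. -/
def HasMatrixDerivAt {m p : Type*} (M : ℝ → Matrix m p ℂ) (M' : Matrix m p ℂ) (t : ℝ) : Prop :=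
  ∀ i j, HasDerivAt (fun s => M s i j) (M' i j) t

theorem HasMatrixDerivAt.mul {m p q : Type*} [Fintype p] {M : ℝ → Matrix m p ℂ}
    {N : ℝ → Matrix p q ℂ} {M' : Matrix m p ℂ} {N' : Matrix p q ℂ} {t : ℝ}
    (hM : HasMatrixDerivAt M M' t) (hN : HasMatrixDerivAt N N' t) :
    HasMatrixDerivAt (fun s => M s * N s) (M' * N t + M t * N') t := by
  intro i j
  simp only [Matrix.mul_apply, Matrix.add_apply, ← Finset.sum_add_distrib]
  exact HasDerivAt.fun_sum fun a _ => (hM i a).mul (hN a j)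

theorem HasMatrixDerivAt.conjTranspose {m p : Type*} {M : ℝ → Matrix m p ℂ} {M' : Matrix m p ℂ}
    {t : ℝ} (hM : HasMatrixDerivAt M M' t) : HasMatrixDerivAt (fun s => (M s)ᴴ) M'ᴴ t :=
  fun i j => (hM j i).star

theorem differentiableAt_det {p : Type*} [Fintype p] [DecidableEq p]
    {M : ℝ → Matrix p p ℂ} {t : ℝ}
    (hM : ∀ i j, DifferentiableAt ℝ (fun s => M s i j) t) :
    DifferentiableAt ℝ (fun s => (M s).det) t := by
  simp only [Matrix.det_apply]
  exact DifferentiableAt.fun_sum fun σ _ =>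
    (DifferentiableAt.fun_finsetProd fun i _ => hM _ _).const_smul _

theorem differentiableAt_matrix_inv {p : Type*} [Fintype p] [DecidableEq p]
    {M : ℝ → Matrix p p ℂ} {t : ℝ}
    (hM : ∀ i j, DifferentiableAt ℝ (fun s => M s i j) t) (hdet : (M t).det ≠ 0) (i j : p) :
    DifferentiableAt ℝ (fun s => (M s)⁻¹ i j) t := by
  simp only [Matrix.inv_def, Ring.inverse_eq_inv', Matrix.smul_apply, smul_eq_mul,
    Matrix.adjugate_apply]
  refine ((differentiableAt_det hM).fun_inv hdet).fun_mul (differentiableAt_det fun a b => ?_)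
  by_cases h : a = j
  · subst h; simp only [Matrix.updateRow_self]; exact differentiableAt_const _
  · simp only [Matrix.updateRow_ne h]; exact hM a b

theorem HasMatrixDerivAt.inv {p : Type*} [Fintype p] [DecidableEq p] {M : ℝ → Matrix p p ℂ}
    {M' : Matrix p p ℂ} {t : ℝ} (hM : HasMatrixDerivAt M M' t)
    (hdet : ∀ᶠ s in 𝓝 t, (M s).det ≠ 0) :
    HasMatrixDerivAt (fun s => (M s)⁻¹) (-((M t)⁻¹ * M' * (M t)⁻¹)) t := by
  have hd := hdet.self_of_nhds
  -- The cofactor formula gives existence of the derivative; its value is then forced by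
  -- differentiating `M⁻¹ M = 1`.
  obtain ⟨N', hN'⟩ : ∃ N', HasMatrixDerivAt (fun s => (M s)⁻¹) N' t :=
    ⟨Matrix.of fun i j => deriv (fun s => (M s)⁻¹ i j) t, fun i j =>
      (differentiableAt_matrix_inv (fun a b => (hM a b).differentiableAt) hd i j).hasDerivAt⟩
  have h1 : N' * M t + (M t)⁻¹ * M' = 0 := by
    ext i j
    refine (hN'.mul hM i j).unique ?_
    refine (hasDerivAt_const t ((1 : Matrix p p ℂ) i j)).congr_of_eventuallyEq ?_
    filter_upwards [hdet] with s hs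
    rw [Matrix.nonsing_inv_mul _ hs.isUnit]
  have h2 : M t * (M t)⁻¹ = 1 := Matrix.mul_nonsing_inv _ hd.isUnit
  have h4 := congrArg (· * (M t)⁻¹) h1
  simp only [Matrix.add_mul, Matrix.mul_assoc, h2, Matrix.mul_one, Matrix.zero_mul] at h4
  rw [Matrix.mul_assoc, ← eq_neg_of_add_eq_zero_left h4]
  exact hN'

theorem hasDerivAt_gradSq {g : ℝ → MatrixField n} {f : ℝ → Cn n → ℂ} {t : ℝ} {z : Cn n}
    {gt : Matrix (Fin n) (Fin n) ℂ} {Vt : Matrix (Fin n) (Fin 1) ℂ}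
    (hpos : ∀ᶠ s in 𝓝 t, (g s z).PosDef) (hg : HasMatrixDerivAt (fun s => g s z) gt t)
    (hV : HasMatrixDerivAt (fun s => gradCol (f s) z) Vt t)
    {W : Matrix (Fin n) (Fin 1) ℂ} (hW : W = (g t z)⁻¹ * gradCol (f t) z) :
    HasDerivAt (fun s => gradSq (g s) (f s) z) ((Vtᴴ * W - Wᴴ * gt * W + Wᴴ * Vt) 0 0) t := by
  have h := (hV.conjTranspose.mul (hg.inv (hpos.mono fun s hs => hs.det_pos.ne'))).mul hV 0 0
  have hHH : ((g t z)⁻¹)ᴴ = (g t z)⁻¹ := hpos.self_of_nhds.isHermitian.inv.eq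
  have h' : HasDerivAt (fun s => gradSq (g s) (f s) z) _ t := h
  refine h'.congr_deriv (congrFun (congrFun ?_ 0) 0)
  rw [hW]
  simp only [conjTranspose_mul, hHH, Matrix.add_mul, Matrix.mul_assoc, Matrix.mul_neg,
    Matrix.neg_mul]
  abel

/-- Smoothness on `(-∞, 0) × ℂⁿ`. -/
def SmoothForNegTime {E F : Type*} [NormedAddCommGroup E] [NormedSpace ℝ E]
    [NormedAddCommGroup F] [NormedSpace ℝ F] (u : ℝ → E → F) : Prop :=
  ∀ t < 0, ∀ z, ContDiffAt ℝ ∞ (fun p : ℝ × E => u p.1 p.2) (t, z)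

theorem fderiv_slice {E F : Type*} [NormedAddCommGroup E] [NormedSpace ℝ E]
    [NormedAddCommGroup F] [NormedSpace ℝ F] {u : ℝ → E → F} (hu : SmoothForNegTime u) {t : ℝ}
    (ht : t < 0) (z e : E) :
    fderiv ℝ (u t) z e = fderiv ℝ (fun p : ℝ × E => u p.1 p.2) (t, z) (0, e) := by
  have h1 := ((hu t ht z).differentiableAt (by simp)).hasFDerivAt
  have h2 : HasFDerivAt (fun w : E => (t, w)) (ContinuousLinearMap.inr ℝ ℝ E) z :=
    hasFDerivAt_prodMk_right t z
  have h3 : HasFDerivAt (u t) _ z := h1.comp z h2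
  rw [h3.fderiv]; rfl

theorem SmoothForNegTime.fderiv_apply {E F : Type*} [NormedAddCommGroup E] [NormedSpace ℝ E]
    [NormedAddCommGroup F] [NormedSpace ℝ F] {u : ℝ → E → F} (hu : SmoothForNegTime u)
    (e : E) : SmoothForNegTime fun t z => fderiv ℝ (u t) z e := by
  intro t ht z
  have h := ((hu t ht z).fderiv_right (m := ∞) (by simp)).clm_apply
    (contDiffAt_const (c := ((0 : ℝ), e)))
  refine h.congr_of_eventuallyEq ?_
  filter_upwards [continuousAt_fst.eventually (Iio_mem_nhds (show (t, z).1 < 0 from ht))]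
    with p hp
  exact fderiv_slice hu hp p.2 e

theorem SmoothForNegTime.wirtinger {u : ℝ → Cn n → ℂ} (hu : SmoothForNegTime u) (c : ℂ)
    (k : Fin n) : SmoothForNegTime fun t => wirtinger c k (u t) := fun t ht z =>
  (((hu.fderiv_apply _ t ht z)).add (contDiffAt_const.mul (hu.fderiv_apply _ t ht z))).div_const 2

/-- Time and space derivatives commute. -/
theorem hasDerivAt_wirtinger {u : ℝ → Cn n → ℂ} (hu : SmoothForNegTime u) {t : ℝ} (ht : t < 0)
    {u' : Cn n → ℂ} (hu' : ∀ z, HasDerivAt (fun s => u s z) (u' z) t) (c : ℂ) (k : Fin n)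
    (z : Cn n) : HasDerivAt (fun s => wirtinger c k (u s) z) (wirtinger c k u' z) t := by
  set F : ℝ × Cn n → ℂ := fun p => u p.1 p.2 with hF
  have hline : ∀ w, HasFDerivAt (fun s : ℝ => (s, w)) (ContinuousLinearMap.inl ℝ ℝ (Cn n)) t :=
    fun w => hasFDerivAt_prodMk_left t w
  have e1 : u' = fun w => fderiv ℝ F (t, w) (1, 0) := by
    funext w
    have h1 := ((hu t ht w).differentiableAt (by simp)).hasFDerivAt
    have h2 : HasFDerivAt (fun s => u s w) _ t := HasFDerivAt.comp (f := fun s : ℝ => (s, w)) t h1 (hline w)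
    rw [(hu' w).unique h2.hasDerivAt]; rfl
  have hFF : DifferentiableAt ℝ (fderiv ℝ F) (t, z) :=
    ((hu t ht z).fderiv_right (m := ∞) (by simp)).differentiableAt (by simp)
  have key : ∀ e, HasDerivAt (fun s => fderiv ℝ (u s) z e) (fderiv ℝ u' z e) t := by
    intro e
    have h1 : HasDerivAt (fun s => fderiv ℝ F (s, z) (0, e))
        (fderiv ℝ (fderiv ℝ F) (t, z) (1, 0) (0, e)) t := by
      have h2 : HasFDerivAt (fun p => fderiv ℝ F p (0, e)) _ (t, z) :=
        hFF.hasFDerivAt.clm_apply (hasFDerivAt_const ((0 : ℝ), e) (t, z))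
      have h3 : HasFDerivAt (fun s => fderiv ℝ F (s, z) (0, e)) _ t := 
        HasFDerivAt.comp (f := fun s : ℝ => (s, z)) t h2 (hline z)
      convert h3.hasDerivAt using 1
      simp
    have h2 : fderiv ℝ u' z e = fderiv ℝ (fderiv ℝ F) (t, z) (1, 0) (0, e) := by
      -- The exchange of time and space derivatives is the symmetry of the second derivative on the
      -- product `ℝ × ℂⁿ`, applied to `(1, 0)` and `(0, e)`.
      rw [fderiv_fderiv_comm (hu t ht z), e1]
      have h2 : HasFDerivAt (fun p => fderiv ℝ F p (1, 0)) _ (t, z) :=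
        hFF.hasFDerivAt.clm_apply (hasFDerivAt_const ((1 : ℝ), (0 : Cn n)) (t, z))
      have h3 : HasFDerivAt (fun w => fderiv ℝ F (t, w) (1, 0)) _ z :=
        h2.comp z (hasFDerivAt_prodMk_right t z)
      rw [h3.fderiv]
      simp [hF]
    rw [h2]
    refine h1.congr_of_eventuallyEq ?_
    filter_upwards [Iio_mem_nhds ht] with s hs
    exact fderiv_slice hu hs z e
  exact ((key _).add ((key _).const_mul c)).div_const 2

theorem IsAncientPluriclosedFlow.smoothMatrix {g : ℝ → MatrixField n}
    (hg : IsAncientPluriclosedFlow g) {t : ℝ} (ht : t ≤ 0) : SmoothMatrix (g t) := by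
  intro i j
  have h1 : ContDiff ℝ ∞ fun w : Cn n => (t, w) := contDiff_const.prodMk contDiff_id
  exact contDiffOn_univ.1 ((hg.smooth i j).comp h1.contDiffOn fun w _ => ⟨ht, mem_univ _⟩)

/-- The heat equation for `f` makes `|∂f|²` a subsolution of the heat equation, if the metrics
evolve by the pluriclosed flow. -/
theorem exists_hasDerivAt_gradSq {g : ℝ → MatrixField 2} (hg : IsAncientPluriclosedFlow g)
    {f : ℝ → Cn 2 → ℂ} (hf : SmoothForNegTime f) {t : ℝ} (ht : t < 0)
    (hft : ContDiff ℝ ∞ (f t))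
    (hheat : ∀ z, HasDerivAt (fun s => f s z) (chernLaplacian (g t) (f t) z) t) (z : Cn 2) :
    ∃ u', HasDerivAt (fun s => gradSq (g s) (f s) z) u' t ∧
      u' - chernLaplacian (g t) (gradSq (g t) (f t)) z ≤ 0 := by
  have hsm := hg.smoothMatrix ht.le
  have hpos := hg.posDef t ht.le
  have hdet : ∀ z, (g t z).det ≠ 0 := fun z => (hpos z).det_pos.ne'
  have hgt : HasMatrixDerivAt (fun s => g s z) (Matrix.of fun i j =>
      (∑ k, ∑ l, (g t z)⁻¹ l k *
        (mwirtinger (-I) k (mwirtinger I l (g t)) z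
          - mwirtinger (-I) k (g t) z * (g t z)⁻¹ * (mwirtinger (-I) l (g t) z)ᴴ) i j)
      + (torsionMatrix (fun k => mwirtinger (-I) k (g t) z) i * (g t z)⁻¹
        * (torsionMatrix (fun k => mwirtinger (-I) k (g t) z) j)ᴴ * (g t z)⁻¹).trace) t := by
    intro i j
    -- The factor `2 / I` undoes the `I / 2` of the Kähler form, turning the flow of `ω` into that
    -- of `g`.
    have h := ((hg.flow t ht.le z i j).hasDerivAt (Iic_mem_nhds ht)).const_mul (2 / I)
    rw [neg_pluriclosedOperator hsm hpos (hg.pluriclosed t ht.le)] at h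
    have hI : (2 / I * (I / 2) : ℂ) = 1 := by field_simp
    simp only [kahlerForm, of_apply, ← mul_assoc, hI, one_mul] at h
    simpa only [of_apply, mul_assoc] using h
  have hVt : HasMatrixDerivAt (fun s => gradCol (f s) z)
      (Matrix.of fun i _ => wirtinger (-I) i (chernLaplacian (g t) (f t)) z) t := fun i j =>
    hasDerivAt_wirtinger hf ht hheat (-I) i z
  refine ⟨_, hasDerivAt_gradSq ?_ hgt hVt rfl, ?_⟩
  · filter_upwards [Iio_mem_nhds ht] with s hs using hg.posDef s (le_of_lt hs) z
  have hL : chernLaplacian (g t) (gradSq (g t) (f t)) z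
      = ∑ k, ∑ l, (g t z)⁻¹ l k * (mwirtinger (-I) k (mwirtinger I l fun w =>
        (gradCol (f t) w)ᴴ * (g t w)⁻¹ * gradCol (f t) w) z) 0 0 := chernLaplacian_eq _ _ _
  rw [hL]
  simp only [mwirtinger_gradSq hsm hpos hft _ _ z rfl rfl]
  exact evolution_algebra (hpos z).inv.posSemidef _ _ _ _ _ _ _ rfl
    (fun i => wirtinger_chernLaplacian hsm hdet hft i z) (fun i j => rfl)

end

/-! ### The maximum principle -/

section

open Matrix Filter Topology

theorem fderiv_fderiv_nonpos_of_isLocalMax {E : Type*} [NormedAddCommGroup E] [NormedSpace ℝ E]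
    {φ : E → ℝ} (hφ : ContDiff ℝ ∞ φ) {z : E} (hz : IsLocalMax φ z) (e : E) :
    fderiv ℝ (fderiv ℝ φ) z e e ≤ 0 := by
  by_contra! hpos
  have hline : ∀ s : ℝ, HasDerivAt (fun s : ℝ => z + s • e) e s := fun s => by
    simpa using ((hasDerivAt_id s).smul_const e).const_add z
  have h1 : ∀ s, HasDerivAt (fun s : ℝ => φ (z + s • e)) (fderiv ℝ φ (z + s • e) e) s := fun s =>
    (ContDiff.differentiableAt_infty hφ _).hasFDerivAt.comp_hasDerivAt s (hline s)
  have hd : deriv (fun s : ℝ => φ (z + s • e)) = fun s => fderiv ℝ φ (z + s • e) e :=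
    funext fun s => (h1 s).deriv
  have hz0 : z + (0 : ℝ) • e = z := by simp
  have h2 : HasDerivAt (fun s : ℝ => fderiv ℝ φ (z + s • e) e)
      (fderiv ℝ (fderiv ℝ φ) z e e) 0 := by
    have hs : ContDiff ℝ ∞ (fun w => fderiv ℝ φ w e) :=
      (hφ.fderiv_right (m := ∞) (by simp)).clm_apply contDiff_const
    have := (ContDiff.differentiableAt_infty hs (z + (0 : ℝ) • e)).hasFDerivAt.comp_hasDerivAt 0
      (hline 0)
    rwa [fderiv_fderiv_apply (by rw [hz0]; exact hφ.contDiffAt), hz0] at this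
  have hcont : ContinuousAt (fun s : ℝ => z + s • e) 0 := (hline 0).continuousAt
  have hmax : IsLocalMax (fun s : ℝ => φ (z + s • e)) 0 := by
    have : ∀ᶠ w in 𝓝 (z + (0 : ℝ) • e), φ w ≤ φ (z + (0 : ℝ) • e) := by rw [hz0]; exact hz
    exact hcont.eventually this
  -- A positive second derivative would make the maximum along the line a local minimum as well. The
  -- restriction would then be locally constant, with zero second derivative.
  have hmin : IsLocalMin (fun s : ℝ => φ (z + s • e)) 0 := by
    refine isLocalMin_of_deriv_deriv_pos ?_ hmax.deriv_eq_zero (h1 0).continuousAt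
    rw [hd, h2.deriv]; exact hpos
  have hconst : (fun s : ℝ => φ (z + s • e)) =ᶠ[𝓝 0] fun _ => φ (z + (0 : ℝ) • e) := by
    filter_upwards [hmax, hmin] with s hs1 hs2 using le_antisymm hs1 hs2
  have h3 := hconst.deriv.deriv_eq
  rw [hd, h2.deriv] at h3
  simp at h3
  exact hpos.ne' h3

/-- Left difference quotients are nonnegative. Only past times are compared, because the space-time
maximum may sit at the final time. -/
theorem nonneg_of_hasDerivAt_of_le {h : ℝ → ℝ} {h' a t : ℝ} (hat : a < t)
    (hd : HasDerivAt h h' t) (hle : ∀ s ∈ Icc a t, h s ≤ h t) : 0 ≤ h' := by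
  have h1 := hd.tendsto_slope.mono_left (nhdsWithin_mono t (fun s (hs : s ∈ Iio t) => ne_of_lt hs))
  refine ge_of_tendsto h1 ?_
  filter_upwards [Ioo_mem_nhdsLT hat] with s hs
  rw [slope_def_field]
  exact div_nonneg_of_nonpos (sub_nonpos.2 (hle s ⟨hs.1.le, hs.2.le⟩)) (sub_nonpos.2 hs.2.le)

theorem fderiv_ofReal_apply {E : Type*} [NormedAddCommGroup E] [NormedSpace ℝ E] {φ : E → ℝ}
    {z : E} (h : DifferentiableAt ℝ φ z) (e : E) :
    fderiv ℝ (fun w => (φ w : ℂ)) z e = (fderiv ℝ φ z e : ℂ) := by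
  have : HasFDerivAt (fun w => (φ w : ℂ)) _ z := ofRealCLM.hasFDerivAt.comp z h.hasFDerivAt
  rw [this.fderiv]; rfl

theorem contDiff_ofReal_comp {E : Type*} [NormedAddCommGroup E] [NormedSpace ℝ E] {φ : E → ℝ}
    (h : ContDiff ℝ ∞ φ) : ContDiff ℝ ∞ fun w => (φ w : ℂ) := ofRealCLM.contDiff.comp h

theorem wirtinger_ofReal (c : ℂ) (k : Fin n) {φ : Cn n → ℝ} (hφ : ContDiff ℝ ∞ φ) (z : Cn n) :
    wirtinger c k (fun w => (φ w : ℂ)) z = ((fderiv ℝ φ z (EuclideanSpace.single k 1) : ℂ)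
      + c * (fderiv ℝ φ z (EuclideanSpace.single k I) : ℂ)) / 2 := by
  simp only [wirtinger, fderiv_ofReal_apply (ContDiff.differentiableAt_infty hφ z)]

theorem wirtinger_I_ofReal (k : Fin n) {φ : Cn n → ℝ} (hφ : ContDiff ℝ ∞ φ) (z : Cn n) :
    wirtinger I k (fun w => (φ w : ℂ)) z = star (wirtinger (-I) k (fun w => (φ w : ℂ)) z) := by
  rw [wirtinger_ofReal I k hφ, wirtinger_ofReal (-I) k hφ]
  simp

theorem wirtinger_wirtinger_ofReal (c c' : ℂ) (k l : Fin n) {φ : Cn n → ℝ}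
    (hφ : ContDiff ℝ ∞ φ) (z : Cn n) :
    wirtinger c k (wirtinger c' l (fun w => (φ w : ℂ))) z =
      ((fderiv ℝ (fderiv ℝ φ) z (EuclideanSpace.single k 1) (EuclideanSpace.single l 1) : ℂ)
      + c' * (fderiv ℝ (fderiv ℝ φ) z (EuclideanSpace.single k 1) (EuclideanSpace.single l I) : ℂ)
      + c * ((fderiv ℝ (fderiv ℝ φ) z (EuclideanSpace.single k I) (EuclideanSpace.single l 1) : ℂ)
      + c' * (fderiv ℝ (fderiv ℝ φ) z (EuclideanSpace.single k I)
        (EuclideanSpace.single l I) : ℂ))) / 4 := by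
  have h2 : ∀ e e' : Cn n, fderiv ℝ (fderiv ℝ (fun w => (φ w : ℂ))) z e e'
      = (fderiv ℝ (fderiv ℝ φ) z e e' : ℂ) := by
    intro e e'
    have hs : ContDiff ℝ ∞ (fun w => fderiv ℝ φ w e') :=
      (hφ.fderiv_right (m := ∞) (by simp)).clm_apply contDiff_const
    rw [← fderiv_fderiv_apply (contDiff_ofReal_comp hφ).contDiffAt,
      ← fderiv_fderiv_apply hφ.contDiffAt,
      ← fderiv_ofReal_apply (ContDiff.differentiableAt_infty hs z)]
    congr 2
    funext w
    exact fderiv_ofReal_apply (ContDiff.differentiableAt_infty hφ w) e'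
  rw [wirtinger]
  simp only [fderiv_wirtinger _ _ (contDiff_ofReal_comp hφ), h2]
  ring

/-- The vector with complex coordinates `x`, as a sum over the coordinate axes. -/
def axisSum (x : Fin n → ℂ) : Cn n := ∑ k, EuclideanSpace.single k (x k)

theorem map_axisSum {F : Type*} [AddCommGroup F] [Module ℝ F]
    (L : Cn n →ₗ[ℝ] F) (x : Fin n → ℂ) : L (axisSum x)
      = ∑ k, ((x k).re • L (EuclideanSpace.single k 1)
        + (x k).im • L (EuclideanSpace.single k I)) := by
  rw [axisSum, map_sum]
  refine Finset.sum_congr rfl fun k _ => ?_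
  rw [← map_smul, ← map_smul, ← map_add]
  congr 1
  ext j
  by_cases h : j = k
  · subst h; simp [Complex.re_add_im]
  · simp [h]

/-- The complex-linear part of a real functional, up to a factor: pairing with `2∂` sends `x` to `L
x - i L(i x)`. -/
theorem sum_mul_sub_I_mul (L : Cn n →ₗ[ℝ] ℝ) (x : Fin n → ℂ) :
    ∑ k, x k * ((L (EuclideanSpace.single k 1) : ℂ) - I * (L (EuclideanSpace.single k I) : ℂ))
      = (L (axisSum x) : ℂ) - I * (L (axisSum fun k => I * x k) : ℂ) := by
  rw [map_axisSum, map_axisSum, ofReal_sum, ofReal_sum, Finset.mul_sum, ← Finset.sum_sub_distrib]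
  refine Finset.sum_congr rfl fun k _ => ?_
  simp only [smul_eq_mul, ofReal_add, ofReal_mul, I_mul_re, I_mul_im, ofReal_neg]
  conv_lhs => rw [← re_add_im (x k)]
  linear_combination (-(x k).im * L (EuclideanSpace.single k I) : ℂ) * I_mul_I

theorem sum_mul_add_I_mul (L : Cn n →ₗ[ℝ] ℝ) (x : Fin n → ℂ) :
    ∑ k, star (x k) * ((L (EuclideanSpace.single k 1) : ℂ)
        + I * (L (EuclideanSpace.single k I) : ℂ))
      = (L (axisSum x) : ℂ) + I * (L (axisSum fun k => I * x k) : ℂ) := by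
  have h := congrArg star (sum_mul_sub_I_mul L x)
  simpa using h

/-- The complex Hessian of a real function is negative semidefinite at a local maximum. -/
theorem posSemidef_neg_complexHessian {φ : Cn n → ℝ} (hφ : ContDiff ℝ ∞ φ) {z : Cn n}
    (hz : IsLocalMax φ z) :
    (-(Matrix.of fun k l => wirtinger (-I) k (wirtinger I l (fun w => (φ w : ℂ))) z)).PosSemidef := by
  have hsymm := fun e e' => fderiv_fderiv_comm hφ.contDiffAt (z := z) e e'
  refine PosSemidef.of_dotProduct_mulVec_nonneg ?_ ?_
  · ext k l
    simp only [conjTranspose_apply, Matrix.neg_apply, of_apply, wirtinger_wirtinger_ofReal _ _ _ _ hφ]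
    rw [hsymm (EuclideanSpace.single l 1), hsymm (EuclideanSpace.single l 1),
      hsymm (EuclideanSpace.single l I), hsymm (EuclideanSpace.single l I)]
    simp
    ring
  · intro x
    -- The conjugate appears because the holomorphic index `k` is contracted with `star x`.
    let y : Fin n → ℂ := fun k => star (x k)
    let B := fderiv ℝ (fderiv ℝ φ) z
    -- The complex Hessian form is a quarter of the sum of the real Hessian on `y` and on `i y`; the
    -- mixed terms cancel by symmetry.
    have key : star x ⬝ᵥ (Matrix.of fun k l =>
        wirtinger (-I) k (wirtinger I l (fun w => (φ w : ℂ))) z) *ᵥ x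
        = (B (axisSum y) (axisSum y) + B (axisSum fun k => I * y k) (axisSum fun k => I * y k) : ℝ)
          / 4 := by
      have e1 : star x ⬝ᵥ (Matrix.of fun k l =>
          wirtinger (-I) k (wirtinger I l (fun w => (φ w : ℂ))) z) *ᵥ x
          = ∑ k, y k * (∑ l, star (y l) * ((B (EuclideanSpace.single k 1)
              (EuclideanSpace.single l 1) : ℂ) + I * (B (EuclideanSpace.single k 1)
              (EuclideanSpace.single l I) : ℂ))
            - I * ∑ l, star (y l) * ((B (EuclideanSpace.single k I)
              (EuclideanSpace.single l 1) : ℂ) + I * (B (EuclideanSpace.single k I)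
              (EuclideanSpace.single l I) : ℂ))) / 4 := by
        simp only [dotProduct, mulVec, of_apply, wirtinger_wirtinger_ofReal _ _ _ _ hφ, Pi.star_apply]
        refine Finset.sum_congr rfl fun k _ => ?_
        rw [mul_div_assoc]
        congr 1
        rw [Finset.mul_sum, ← Finset.sum_sub_distrib, Finset.sum_div]
        refine Finset.sum_congr rfl fun l _ => ?_
        simp only [y, star_star, B]
        ring
      have e2 : ∀ k, ∑ l, star (y l) * ((B (EuclideanSpace.single k 1)
              (EuclideanSpace.single l 1) : ℂ) + I * (B (EuclideanSpace.single k 1)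
              (EuclideanSpace.single l I) : ℂ))
            - I * ∑ l, star (y l) * ((B (EuclideanSpace.single k I)
              (EuclideanSpace.single l 1) : ℂ) + I * (B (EuclideanSpace.single k I)
              (EuclideanSpace.single l I) : ℂ))
          = ((B.flip (axisSum y) (EuclideanSpace.single k 1) : ℂ)
              - I * (B.flip (axisSum y) (EuclideanSpace.single k I) : ℂ))
            + I * ((B.flip (axisSum fun k => I * y k) (EuclideanSpace.single k 1) : ℂ)
              - I * (B.flip (axisSum fun k => I * y k) (EuclideanSpace.single k I) : ℂ)) := by
        intro k
        have a1 := sum_mul_add_I_mul (B (EuclideanSpace.single k 1) : Cn n →ₗ[ℝ] ℝ) y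
        have a2 := sum_mul_add_I_mul (B (EuclideanSpace.single k I) : Cn n →ₗ[ℝ] ℝ) y
        simp only [ContinuousLinearMap.coe_coe] at a1 a2
        rw [a1, a2]
        simp only [ContinuousLinearMap.flip_apply]
        ring
      have a3 := sum_mul_sub_I_mul (B.flip (axisSum y) : Cn n →ₗ[ℝ] ℝ) y
      have a4 := sum_mul_sub_I_mul (B.flip (axisSum fun k => I * y k) : Cn n →ₗ[ℝ] ℝ) y
      simp only [ContinuousLinearMap.coe_coe] at a3 a4
      rw [e1, ← Finset.sum_div]
      have e3 : ∀ X Y : Fin n → ℂ, ∑ k, y k * (X k + I * Y k)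
          = ∑ k, y k * X k + I * ∑ k, y k * Y k := fun X Y => by
        rw [Finset.mul_sum, ← Finset.sum_add_distrib]
        exact Finset.sum_congr rfl fun k _ => by ring
      rw [Finset.sum_congr rfl fun k _ => congrArg (y k * ·) (e2 k), e3, a3, a4]
      simp only [ContinuousLinearMap.flip_apply]
      have hs : B (axisSum y) (axisSum fun k => I * y k) = B (axisSum fun k => I * y k) (axisSum y) :=
        hsymm _ _
      rw [hs]
      push_cast
      linear_combination (-(B (axisSum fun k => I * y k) (axisSum fun k => I * y k) : ℂ) / 4) * I_mul_I
    have h1 := fderiv_fderiv_nonpos_of_isLocalMax hφ hz (axisSum y)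
    have h2 := fderiv_fderiv_nonpos_of_isLocalMax hφ hz (axisSum fun k => I * y k)
    rw [neg_mulVec, dotProduct_neg, key, ← ofReal_ofNat, ← ofReal_div, ← ofReal_neg]
    refine Complex.zero_le_real.2 ?_
    simp only [B]
    linarith

theorem wirtinger_eq_zero_of_isLocalMax {φ : Cn n → ℝ} (hφ : ContDiff ℝ ∞ φ) {z : Cn n}
    (hz : IsLocalMax φ z) (c : ℂ) (k : Fin n) : wirtinger c k (fun w => (φ w : ℂ)) z = 0 := by
  rw [wirtinger_ofReal c k hφ, hz.fderiv_eq_zero]; simp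

theorem chernLaplacian_nonpos_of_isLocalMax {g : MatrixField n} {φ : Cn n → ℝ}
    (hφ : ContDiff ℝ ∞ φ) {z : Cn n} (hg : (g z).PosDef) (hz : IsLocalMax φ z) :
    chernLaplacian g (fun w => (φ w : ℂ)) z ≤ 0 := by
  have h := trace_mul_nonneg_of_posSemidef hg.inv.posSemidef (posSemidef_neg_complexHessian hφ hz)
  rw [Matrix.mul_neg, trace_neg, neg_nonneg] at h
  rw [chernLaplacian_eq, Finset.sum_comm]
  simpa only [trace, diag_apply, Matrix.mul_apply, of_apply] using h

end

/-! ### The Bernstein estimate -/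

section

open Matrix Filter Topology

/-- The pairing `g^{l̄ k} ∂_k x ∂_l̄ y`. -/
def gradPair (g : MatrixField n) (x y : Cn n → ℂ) (z : Cn n) : ℂ :=
  ∑ k, ∑ l, (g z)⁻¹ l k * (wirtinger (-I) k x z * wirtinger I l y z)

/-- Both orders of `gradPair` occur because this pairing of complex functions need not be symmetric.
-/
theorem chernLaplacian_mul (g : MatrixField n) {x y : Cn n → ℂ} (hx : ContDiff ℝ ∞ x)
    (hy : ContDiff ℝ ∞ y) (z : Cn n) :
    chernLaplacian g (fun w => x w * y w) z = chernLaplacian g x z * y z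
      + x z * chernLaplacian g y z + gradPair g x y z + gradPair g y x z := by
  have hd : ∀ {v : Cn n → ℂ}, ContDiff ℝ ∞ v → DifferentiableAt ℝ v z := fun hv =>
    ContDiff.differentiableAt_infty hv z
  have e : ∀ k l, wirtinger (-I) k (wirtinger I l (fun w => x w * y w)) z
      = wirtinger (-I) k (wirtinger I l x) z * y z + wirtinger I l x z * wirtinger (-I) k y z
        + (wirtinger (-I) k x z * wirtinger I l y z
          + x z * wirtinger (-I) k (wirtinger I l y) z) := fun k l => by
    have hx' := contDiff_wirtinger I l hx
    have hy' := contDiff_wirtinger I l hy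
    have e0 : wirtinger I l (fun w => x w * y w)
        = fun w => wirtinger I l x w * y w + x w * wirtinger I l y w :=
      funext fun w => wirtinger_mul I l (ContDiff.differentiableAt_infty hx w)
        (ContDiff.differentiableAt_infty hy w)
    rw [e0, wirtinger_add _ _ ((hd hx').fun_mul (hd hy))
      ((hd hx).fun_mul (hd hy')), wirtinger_mul _ _ (hd hx') (hd hy),
      wirtinger_mul _ _ (hd hx) (hd hy')]
  simp only [chernLaplacian_eq, gradPair, e, Finset.mul_sum, Finset.sum_mul,
    ← Finset.sum_add_distrib]
  exact Finset.sum_congr rfl fun k _ => Finset.sum_congr rfl fun l _ => by ring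

theorem chernLaplacian_add (g : MatrixField n) {x y : Cn n → ℂ} (hx : ContDiff ℝ ∞ x)
    (hy : ContDiff ℝ ∞ y) (z : Cn n) :
    chernLaplacian g (fun w => x w + y w) z = chernLaplacian g x z + chernLaplacian g y z := by
  have e : ∀ k l, wirtinger (-I) k (wirtinger I l (fun w => x w + y w)) z
      = wirtinger (-I) k (wirtinger I l x) z + wirtinger (-I) k (wirtinger I l y) z :=
    fun k l => by
    have e0 : wirtinger I l (fun w => x w + y w)
        = fun w => wirtinger I l x w + wirtinger I l y w :=
      funext fun w => wirtinger_add I l (ContDiff.differentiableAt_infty hx w)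
        (ContDiff.differentiableAt_infty hy w)
    rw [e0, wirtinger_add _ _
      (ContDiff.differentiableAt_infty (contDiff_wirtinger I l hx) z)
      (ContDiff.differentiableAt_infty (contDiff_wirtinger I l hy) z)]
  simp only [chernLaplacian_eq, e, ← Finset.sum_add_distrib, mul_add]

theorem chernLaplacian_const_mul (g : MatrixField n) (a : ℂ) {x : Cn n → ℂ}
    (hx : ContDiff ℝ ∞ x) (z : Cn n) :
    chernLaplacian g (fun w => a * x w) z = a * chernLaplacian g x z := by
  have e : ∀ k l, wirtinger (-I) k (wirtinger I l (fun w => a * x w)) z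
      = a * wirtinger (-I) k (wirtinger I l x) z := fun k l => by
    have e0 : wirtinger I l (fun w => a * x w) = fun w => a * wirtinger I l x w :=
      funext fun w => wirtinger_const_mul I l a (ContDiff.differentiableAt_infty hx w)
    rw [e0, wirtinger_const_mul _ _ _ (ContDiff.differentiableAt_infty (contDiff_wirtinger I l hx) z)]
  simp only [chernLaplacian_eq, e, Finset.mul_sum]
  exact Finset.sum_congr rfl fun k _ => Finset.sum_congr rfl fun l _ => by ring

theorem _root_.Matrix.PosSemidef.sum_mul_nonneg {p : Type*} [Fintype p] {H : Matrix p p ℂ}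
    (hH : H.PosSemidef) (a : p → ℂ) : 0 ≤ ∑ k, ∑ l, H l k * (a k * star (a l)) := by
  have h := hH.dotProduct_mulVec_nonneg a
  rw [Finset.sum_comm]
  convert h using 1
  simp only [dotProduct, mulVec, Finset.mul_sum, Pi.star_apply]
  exact Finset.sum_congr rfl fun k _ => Finset.sum_congr rfl fun l _ => by ring

theorem gradSq_eq_gradPair (g : MatrixField n) {φ : Cn n → ℝ} (hφ : ContDiff ℝ ∞ φ) (z : Cn n) :
    gradSq g (fun w => (φ w : ℂ)) z
      = gradPair g (fun w => (φ w : ℂ)) (fun w => (φ w : ℂ)) z := by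
  simp only [gradSq, gradPair, Matrix.mul_apply, conjTranspose_apply, gradCol, of_apply,
    wirtinger_I_ofReal _ hφ, Finset.sum_mul]
  exact Finset.sum_congr rfl fun k _ => Finset.sum_congr rfl fun l _ => by ring

theorem gradSq_nonneg {g : MatrixField n} {φ : Cn n → ℂ} {z : Cn n} (hg : (g z).PosDef) :
    0 ≤ gradSq g φ z := (hg.inv.posSemidef.conjTranspose_mul_mul_same (gradCol φ z)).diag_nonneg

theorem contDiff_gradSq {g : MatrixField n} (hg : SmoothMatrix g) (hdet : ∀ z, (g z).det ≠ 0)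
    {f : Cn n → ℂ} (hf : ContDiff ℝ ∞ f) : ContDiff ℝ ∞ (gradSq g f) :=
  (((smoothMatrix_gradCol hf).conjTranspose.mul (hg.inv hdet)).mul (smoothMatrix_gradCol hf)) 0 0

/-- The first and second order conditions at a maximum of `τ ψ² u + f²`, contracted with `∂ψ` and
with the metric. -/
theorem conditions_of_isLocalMax {g : MatrixField 2} {ψ u f : Cn 2 → ℝ} (hψ : ContDiff ℝ ∞ ψ)
    (hu : ContDiff ℝ ∞ u) (hf : ContDiff ℝ ∞ f) {z : Cn 2} (hg : (g z).PosDef) {τ : ℝ}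
    (hz : IsLocalMax (fun w => τ * (ψ w * ψ w * u w) + f w * f w) z)
    {Ψ U F : Cn 2 → ℂ} (hΨ : Ψ = fun w => (ψ w : ℂ)) (hU : U = fun w => (u w : ℂ))
    (hF : F = fun w => (f w : ℂ)) :
    (τ * (4 * ψ z * u z * (gradPair g Ψ Ψ z).re
      + ψ z ^ 2 * (gradPair g U Ψ z + gradPair g Ψ U z).re)
      + 2 * f z * (gradPair g F Ψ z + gradPair g Ψ F z).re = 0) ∧
    (τ * (ψ z ^ 2 * (chernLaplacian g U z).re + u z * (2 * ψ z * (chernLaplacian g Ψ z).re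
      + 2 * (gradPair g Ψ Ψ z).re) + 2 * ψ z * (gradPair g U Ψ z + gradPair g Ψ U z).re)
      + 2 * f z * (chernLaplacian g F z).re + 2 * (gradPair g F F z).re ≤ 0) ∧
    ∀ a : ℝ, 0 ≤ (gradPair g F F z).re - a * (gradPair g F Ψ z + gradPair g Ψ F z).re
      + a ^ 2 * (gradPair g Ψ Ψ z).re := by
  have cΨ : ContDiff ℝ ∞ Ψ := hΨ ▸ contDiff_ofReal_comp hψ
  have cU : ContDiff ℝ ∞ U := hU ▸ contDiff_ofReal_comp hu
  have cF : ContDiff ℝ ∞ F := hF ▸ contDiff_ofReal_comp hf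
  have hd : ∀ {v : Cn 2 → ℂ}, ContDiff ℝ ∞ v → DifferentiableAt ℝ v z := fun hv =>
    ContDiff.differentiableAt_infty hv z
  have hsm : ContDiff ℝ ∞ (fun w => τ * (ψ w * ψ w * u w) + f w * f w) :=
    (contDiff_const.mul ((hψ.mul hψ).mul hu)).add (hf.mul hf)
  have hΦ : (fun w => ((τ * (ψ w * ψ w * u w) + f w * f w : ℝ) : ℂ))
      = fun w => (τ : ℂ) * (Ψ w * Ψ w * U w) + F w * F w := by
    funext w; simp only [hΨ, hU, hF]; push_cast; ring
  have c2 := cΨ.mul cΨ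
  have c3 := c2.mul cU
  have vΨ : Ψ z = (ψ z : ℂ) := by rw [hΨ]
  have vU : U z = (u z : ℂ) := by rw [hU]
  have vF : F z = (f z : ℂ) := by rw [hF]
  -- Vanishing of the first derivatives of the maximized function; below it is contracted with `∂ψ`
  -- and `∂̄ψ` and the two are added, which gives the symmetrized pairings.
  have hfirst : ∀ c k, (τ : ℂ) * (2 * ψ z * u z * wirtinger c k Ψ z
      + ψ z ^ 2 * wirtinger c k U z) + 2 * f z * wirtinger c k F z = 0 := by
    intro c k
    have h := wirtinger_eq_zero_of_isLocalMax hsm hz c k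
    rw [hΦ, wirtinger_add c k (hd (contDiff_const.mul c3)) (hd (cF.mul cF)),
      wirtinger_const_mul c k _ (hd c3), wirtinger_mul c k (hd c2) (hd cU),
      wirtinger_mul c k (hd cΨ) (hd cΨ), wirtinger_mul c k (hd cF) (hd cF), vΨ, vU, vF] at h
    linear_combination h
  refine ⟨?_, ?_, ?_⟩
  · have h : ((τ * (4 * ψ z * u z) : ℝ) : ℂ) * gradPair g Ψ Ψ z
        + ((τ * ψ z ^ 2 : ℝ) : ℂ) * (gradPair g U Ψ z + gradPair g Ψ U z)
        + ((2 * f z : ℝ) : ℂ) * (gradPair g F Ψ z + gradPair g Ψ F z)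
        = 0 := by
      have h1 := fun k => hfirst (-I) k
      have h2 := fun l => hfirst I l
      simp only [gradPair, Fin.sum_univ_two]
      push_cast
      linear_combination
        (g z)⁻¹ 0 0 * (h1 0 * wirtinger I 0 Ψ z + wirtinger (-I) 0 Ψ z * h2 0)
        + (g z)⁻¹ 1 0 * (h1 0 * wirtinger I 1 Ψ z + wirtinger (-I) 0 Ψ z * h2 1)
        + (g z)⁻¹ 0 1 * (h1 1 * wirtinger I 0 Ψ z + wirtinger (-I) 1 Ψ z * h2 0)
        + (g z)⁻¹ 1 1 * (h1 1 * wirtinger I 1 Ψ z + wirtinger (-I) 1 Ψ z * h2 1)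
    have h' := congrArg Complex.re h
    simp only [Complex.add_re, Complex.re_ofReal_mul, Complex.zero_re] at h' ⊢
    linear_combination h'
  · have h := (Complex.le_def.1 (chernLaplacian_nonpos_of_isLocalMax hsm hg hz)).1
    rw [hΦ, chernLaplacian_add g (contDiff_const.mul c3) (cF.mul cF),
      chernLaplacian_const_mul g _ c3, chernLaplacian_mul g c2 cU, chernLaplacian_mul g cΨ cΨ,
      chernLaplacian_mul g cF cF, vΨ, vU, vF] at h
    have e1 : gradPair g (fun w => Ψ w * Ψ w) U z = 2 * ψ z * gradPair g Ψ U z := by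
      simp only [gradPair, wirtinger_mul _ _ (hd cΨ) (hd cΨ), vΨ, Fin.sum_univ_two]; ring
    have e2 : gradPair g U (fun w => Ψ w * Ψ w) z = 2 * ψ z * gradPair g U Ψ z := by
      simp only [gradPair, wirtinger_mul _ _ (hd cΨ) (hd cΨ), vΨ, Fin.sum_univ_two]; ring
    rw [e1, e2] at h
    have e3 : (τ : ℂ) * ((chernLaplacian g Ψ z * ψ z + ψ z * chernLaplacian g Ψ z
        + gradPair g Ψ Ψ z + gradPair g Ψ Ψ z) * u z + ψ z * ψ z * chernLaplacian g U z
        + 2 * ψ z * gradPair g Ψ U z + 2 * ψ z * gradPair g U Ψ z)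
        + (chernLaplacian g F z * f z + f z * chernLaplacian g F z + gradPair g F F z
        + gradPair g F F z)
        = ((τ * ψ z ^ 2 : ℝ) : ℂ) * chernLaplacian g U z
        + ((τ * u z * (2 * ψ z) : ℝ) : ℂ) * chernLaplacian g Ψ z
        + ((τ * u z * 2 : ℝ) : ℂ) * gradPair g Ψ Ψ z
        + ((τ * (2 * ψ z) : ℝ) : ℂ) * (gradPair g U Ψ z + gradPair g Ψ U z)
        + ((2 * f z : ℝ) : ℂ) * chernLaplacian g F z + ((2 : ℝ) : ℂ) * gradPair g F F z := by
      push_cast; ring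
    rw [e3] at h
    simp only [Complex.add_re, Complex.re_ofReal_mul, Complex.zero_re] at h ⊢
    linarith
  · intro a
    -- Expand `|∂f - a ∂ψ|² ≥ 0`, a Cauchy–Schwarz inequality with a free parameter.
    have h := (Complex.le_def.1 (hg.inv.posSemidef.sum_mul_nonneg
      fun k => wirtinger (-I) k F z - a * wirtinger (-I) k Ψ z)).1
    have sΨ : ∀ l, star (wirtinger (-I) l Ψ z) = wirtinger I l Ψ z := fun l => by
      rw [hΨ, wirtinger_I_ofReal l hψ]
    have sF : ∀ l, star (wirtinger (-I) l F z) = wirtinger I l F z := fun l => by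
      rw [hF, wirtinger_I_ofReal l hf]
    have ha : star (a : ℂ) = a := Complex.conj_ofReal a
    simp only [star_sub, star_mul', sΨ, sF, ha] at h
    have e : ∑ k, ∑ l, (g z)⁻¹ l k * ((wirtinger (-I) k F z - a * wirtinger (-I) k Ψ z)
        * (wirtinger I l F z - a * wirtinger I l Ψ z))
        = gradPair g F F z - (a : ℂ) * (gradPair g F Ψ z + gradPair g Ψ F z)
          + ((a ^ 2 : ℝ) : ℂ) * gradPair g Ψ Ψ z := by
      simp only [gradPair, Fin.sum_univ_two]
      push_cast
      ring
    rw [e] at h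
    simpa only [Complex.add_re, Complex.sub_re, Complex.re_ofReal_mul, Complex.zero_re] using h

/-- The conditions at a maximum of `τ ψ² u + f²` contradict the evolution inequalities, if the
cutoff varies slowly. -/
theorem bernstein_contradiction {τ T ψ u f N p q dψ du df ut B δ : ℝ}
    (hgrad : τ * (4 * ψ * u * N + ψ ^ 2 * q) + 2 * f * p = 0)
    (hlap : τ * (ψ ^ 2 * du + u * (2 * ψ * dψ + 2 * N) + 2 * ψ * q) + 2 * f * df + 2 * u ≤ 0)
    (hquad : ∀ a : ℝ, 0 ≤ u - a * p + a ^ 2 * N)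
    (htime : 0 ≤ ψ ^ 2 * u + τ * (ψ ^ 2 * ut) + 2 * f * df) (hut : ut ≤ du)
    (hψ0 : 0 < ψ) (hψ1 : ψ ≤ 1) (hτ0 : 0 < τ) (hτT : τ ≤ T) (hu : 0 < u)
    (hlarge : 1 ≤ τ * ψ ^ 2 * u) (hf : |f| ≤ B) (hN0 : 0 ≤ N) (hN : N ≤ δ) (hdψ : -dψ ≤ 2 * δ)
    (hδ : T * δ * (12 + 32 * B ^ 2) < 1 / 2) : False := by
  have hδ0 : 0 ≤ δ := hN0.trans hN
  -- Here `N = |∂ψ|²`, while `p` and `q` are the symmetrized pairings of `∂ψ` with `∂f` and `∂u`.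
  -- The first-order condition removes `q`, the only term containing derivatives of `u` that has no
  -- sign.
  have hψq : τ * ψ * q = -(4 * τ * u * N) - 2 * f * p / ψ := by
    field_simp
    linear_combination hgrad
  have hf2 : f ^ 2 ≤ B ^ 2 := sq_le_sq' (abs_le.1 hf).1 (abs_le.1 hf).2
  -- This parameter makes the bad term `4 f p / ψ` cost exactly `u / 2`. The good term `2u` loses
  -- `u` to `htime` and `u / 2` here, and the last `u / 2` beats the cutoff errors.
  have hquad' := hquad (8 * f / ψ)
  -- The singular factor `1 / ψ²` is controlled by `τ u`: this is where the assumption that `τ ψ² u`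
  -- is at least `1` enters.
  have hinv : f ^ 2 / ψ ^ 2 ≤ B ^ 2 * (τ * u) := by
    rw [div_le_iff₀ (by positivity)]
    have := mul_le_mul_of_nonneg_left hlarge (sq_nonneg B)
    linarith
  have hfN : f ^ 2 / ψ ^ 2 * N ≤ B ^ 2 * (τ * u) * δ :=
    mul_le_mul hinv hN hN0 (by positivity)
  have hp : 4 * f * p / ψ ≤ u / 2 + 32 * (B ^ 2 * (τ * u) * δ) := by
    have e1 : 8 * f / ψ * p = 2 * (4 * f * p / ψ) := by ring
    have e2 : (8 * f / ψ) ^ 2 * N = 64 * (f ^ 2 / ψ ^ 2 * N) := by ring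
    rw [e1, e2] at hquad'
    linarith
  have h1 : τ * ψ ^ 2 * ut ≤ τ * ψ ^ 2 * du := mul_le_mul_of_nonneg_left hut (by positivity)
  have h2 : ψ ^ 2 * u ≤ u := mul_le_of_le_one_left hu.le (pow_le_one₀ hψ0.le hψ1)
  have h3 : -(τ * u * (2 * ψ * dψ)) ≤ 4 * (τ * u * δ) := by
    have : ψ * -dψ ≤ 2 * δ := by
      rcases le_total 0 (-dψ) with h | h
      · exact (mul_le_of_le_one_left h hψ1).trans hdψ
      · exact (mul_nonpos_of_nonneg_of_nonpos hψ0.le h).trans (by positivity)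
    have := mul_le_mul_of_nonneg_left this (by positivity : 0 ≤ 2 * (τ * u))
    linarith
  have h4 : τ * u * N ≤ τ * u * δ := mul_le_mul_of_nonneg_left hN (by positivity)
  have h4' : 0 ≤ τ * u * N := by positivity
  have h5 : τ * u * δ * (12 + 32 * B ^ 2) < u / 2 := by
    have : τ * δ * (12 + 32 * B ^ 2) ≤ T * δ * (12 + 32 * B ^ 2) := by gcongr
    have := mul_lt_mul_of_pos_right (this.trans_lt hδ) hu
    linarith
  have h6 : 2 * f * p / ψ * 2 = 4 * f * p / ψ := by ring
  have h7 : 0 ≤ τ * u * δ := by positivity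
  linarith

end

/-! ### Cutoff functions and uniform ellipticity. -/

section

open Matrix Filter Topology

theorem posSemidef_smul_one_sub_inv {p : Type*} [Fintype p] [DecidableEq p] {M : Matrix p p ℂ}
    {A : ℝ} (hA : 0 < A) (hM : M.PosDef) (h : (M - A⁻¹ • (1 : Matrix p p ℂ)).PosSemidef) :
    (A • (1 : Matrix p p ℂ) - M⁻¹).PosSemidef := by
  have h1 : M⁻¹ * M = 1 := Matrix.nonsing_inv_mul _ hM.det_pos.ne'.isUnit
  have hH : (M⁻¹)ᴴ = M⁻¹ := hM.isHermitian.inv.eq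
  -- With `K = A - M⁻¹`, the identity `K = A⁻¹ K* K + M⁻¹ (M - A⁻¹) M⁻¹` exhibits `K` as a sum of
  -- positive semidefinite matrices.
  have e : A • (1 : Matrix p p ℂ) - M⁻¹
      = A⁻¹ • ((A • (1 : Matrix p p ℂ) - M⁻¹)ᴴ * (A • (1 : Matrix p p ℂ) - M⁻¹))
        + (M⁻¹)ᴴ * (M - A⁻¹ • (1 : Matrix p p ℂ)) * M⁻¹ := by
    simp only [conjTranspose_sub, conjTranspose_smul, conjTranspose_one, hH, Matrix.mul_sub,
      Matrix.sub_mul, h1, Matrix.one_mul, Matrix.mul_one, smul_mul_assoc, mul_smul_comm,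
      smul_sub, smul_smul, star_trivial]
    have : A⁻¹ * A = 1 := inv_mul_cancel₀ hA.ne'
    simp only [this, ← mul_assoc, one_smul, one_mul]
    abel
  rw [e]
  exact ((posSemidef_conjTranspose_mul_self _).smul (inv_pos.2 hA).le).add
    (h.conjTranspose_mul_mul_same _)

/-- The cutoff function `1 - |z|² / R²`. -/
def cutoff (R : ℝ) (z : Cn n) : ℝ := 1 - ‖z‖ ^ 2 / R ^ 2

theorem contDiff_cutoff (R : ℝ) : ContDiff ℝ ∞ (cutoff R : Cn n → ℝ) :=
  contDiff_const.sub ((contDiff_norm_sq ℝ).div_const _)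

theorem contDiff_coord (j : Fin n) : ContDiff ℝ ∞ fun w : Cn n => w j :=
  ((EuclideanSpace.proj j : Cn n →L[ℂ] ℂ).restrictScalars ℝ).contDiff

theorem wirtinger_coord (c : ℂ) (k j : Fin n) (z : Cn n) :
    wirtinger c k (fun w : Cn n => w j) z = if k = j then (1 + c * I) / 2 else 0 := by
  have h : HasFDerivAt (fun w : Cn n => w j)
      ((EuclideanSpace.proj j : Cn n →L[ℂ] ℂ).restrictScalars ℝ) z :=
    ((EuclideanSpace.proj j : Cn n →L[ℂ] ℂ).restrictScalars ℝ).hasFDerivAt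
  rw [wirtinger, h.fderiv]
  by_cases hk : k = j
  · subst hk; simp
  · have : ¬ j = k := fun h => hk h.symm
    simp [hk, this]

theorem ofReal_cutoff (R : ℝ) : (fun w : Cn n => (cutoff R w : ℂ))
    = fun w => 1 + (-((R : ℂ) ^ 2)⁻¹) * ∑ j, w j * star (w j) := by
  funext w
  have : ((‖w‖ ^ 2 : ℝ) : ℂ) = ∑ j, w j * star (w j) := by
    rw [EuclideanSpace.norm_sq_eq, ofReal_sum]
    refine Finset.sum_congr rfl fun j _ => ?_
    rw [← Complex.normSq_eq_norm_sq, ← Complex.mul_conj]; rfl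
  rw [cutoff, ← this]
  push_cast
  ring

theorem wirtinger_cutoff (c : ℂ) (R : ℝ) (k : Fin n) (z : Cn n) :
    wirtinger c k (fun w => (cutoff R w : ℂ)) z
      = -((R : ℂ) ^ 2)⁻¹ * ((1 + c * I) / 2 * star (z k) + z k * star ((1 + star c * I) / 2)) := by
  have hc := fun j => ContDiff.differentiableAt_infty (contDiff_coord j) z
  have hcs : ∀ j, DifferentiableAt ℝ (fun w : Cn n => star (w j)) z := fun j => (hc j).star
  rw [ofReal_cutoff, wirtinger_add _ _ (differentiableAt_const _)
    ((DifferentiableAt.fun_sum fun j _ => (hc j).fun_mul (hcs j)).const_mul _), wirtinger_const,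
    wirtinger_const_mul _ _ _ (DifferentiableAt.fun_sum fun j _ => (hc j).fun_mul (hcs j)),
    wirtinger_sum _ _ _ fun j _ => (hc j).fun_mul (hcs j)]
  simp only [wirtinger_mul _ _ (hc _) (hcs _), wirtinger_star _ _ (hc _), wirtinger_coord,
    Pi.zero_apply, zero_add]
  congr 1
  rw [Finset.sum_eq_single k]
  · simp
  · intro j _ hj
    simp [hj.symm]
  · simp

theorem wirtinger_I_cutoff (R : ℝ) (k : Fin n) :
    wirtinger I k (fun w : Cn n => (cutoff R w : ℂ)) = fun z => -((R : ℂ) ^ 2)⁻¹ * z k := by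
  funext z; rw [wirtinger_cutoff]; simp

theorem wirtinger_neg_I_cutoff (R : ℝ) (k : Fin n) (z : Cn n) :
    wirtinger (-I) k (fun w : Cn n => (cutoff R w : ℂ)) z = -((R : ℂ) ^ 2)⁻¹ * star (z k) := by
  rw [wirtinger_cutoff]; simp

/-- Since `∂_k ∂_l̄ ψ = -δ_{kl} / R²`, the Laplacian of the cutoff is `-tr(g⁻¹) / R²`. -/
theorem neg_chernLaplacian_cutoff_le {g : MatrixField n} {A R : ℝ} {z : Cn n}
    (h : (A • (1 : Matrix (Fin n) (Fin n) ℂ) - (g z)⁻¹).PosSemidef) :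
    -(chernLaplacian g (fun w => (cutoff R w : ℂ)) z).re ≤ n * (A / R ^ 2) := by
  have e : chernLaplacian g (fun w => (cutoff R w : ℂ)) z
      = ((-(R ^ 2)⁻¹ : ℝ) : ℂ) * ((g z)⁻¹).trace := by
    rw [chernLaplacian_eq]
    have : ∀ k l, wirtinger (-I) k (wirtinger I l (fun w : Cn n => (cutoff R w : ℂ))) z
        = if k = l then -((R : ℂ) ^ 2)⁻¹ else 0 := fun k l => by
      rw [wirtinger_I_cutoff, wirtinger_const_mul _ _ _
        (ContDiff.differentiableAt_infty (contDiff_coord l) z), wirtinger_coord]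
      by_cases hk : k = l <;> simp [hk]
    simp only [this, mul_ite, mul_zero, Finset.sum_ite_eq, Finset.mem_univ, if_true, trace,
      diag_apply, Finset.mul_sum]
    push_cast
    exact Finset.sum_congr rfl fun k _ => mul_comm _ _
  have h1 := (Complex.le_def.1 h.trace_nonneg).1
  have h2 : (A • (1 : Matrix (Fin n) (Fin n) ℂ)).trace.re = A * n := by
    rw [trace_smul, trace_one]; simp
  rw [trace_sub, Complex.sub_re, h2, Complex.zero_re] at h1
  rw [e, Complex.re_ofReal_mul]
  have h3 : (0 : ℝ) ≤ (R ^ 2)⁻¹ := by positivity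
  have := mul_le_mul_of_nonneg_left (sub_nonneg.1 h1) h3
  calc _ = (R ^ 2)⁻¹ * ((g z)⁻¹).trace.re := by ring
    _ ≤ _ := this
    _ = _ := by ring

/-- The gradient of the cutoff has squared norm `R⁻⁴` times the form `g⁻¹` evaluated on the position
vector; this is at most `A ‖z‖² / R⁴`. -/
theorem gradPair_cutoff_le {g : MatrixField n} {A R : ℝ} {z : Cn n} (hA : 0 ≤ A) (hR : 0 < R)
    (hz : ‖z‖ ≤ R) (h : (A • (1 : Matrix (Fin n) (Fin n) ℂ) - (g z)⁻¹).PosSemidef) :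
    (gradPair g (fun w => (cutoff R w : ℂ)) (fun w => (cutoff R w : ℂ)) z).re ≤ A / R ^ 2 := by
  have h0 := (Complex.le_def.1 (h.sum_mul_nonneg fun k => star (z k))).1
  have e1 : ∑ k, ∑ l, (A • (1 : Matrix (Fin n) (Fin n) ℂ) - (g z)⁻¹) l k
      * (star (z k) * star (star (z l)))
      = ((A * ‖z‖ ^ 2 : ℝ) : ℂ) - ∑ k, ∑ l, (g z)⁻¹ l k * (star (z k) * z l) := by
    have : ((‖z‖ ^ 2 : ℝ) : ℂ) = ∑ j, z j * star (z j) := by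
      rw [EuclideanSpace.norm_sq_eq, ofReal_sum]
      refine Finset.sum_congr rfl fun j _ => ?_
      rw [← Complex.normSq_eq_norm_sq, ← Complex.mul_conj]; rfl
    rw [ofReal_mul, this, Finset.mul_sum, ← Finset.sum_sub_distrib]
    refine Finset.sum_congr rfl fun k _ => ?_
    simp only [Matrix.sub_apply, Matrix.smul_apply, Matrix.one_apply, sub_mul,
      Finset.sum_sub_distrib, star_star, smul_ite, smul_zero, ite_mul, zero_mul,
      Finset.sum_ite_eq', Finset.mem_univ, if_true, Complex.real_smul, mul_one]
    ring
  have e2 : gradPair g (fun w => (cutoff R w : ℂ)) (fun w => (cutoff R w : ℂ)) z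
      = (((R ^ 4)⁻¹ : ℝ) : ℂ) * ∑ k, ∑ l, (g z)⁻¹ l k * (star (z k) * z l) := by
    simp only [gradPair, wirtinger_I_cutoff, wirtinger_neg_I_cutoff, Finset.mul_sum]
    refine Finset.sum_congr rfl fun k _ => Finset.sum_congr rfl fun l _ => ?_
    push_cast
    rw [show (R : ℂ) ^ 4 = (R : ℂ) ^ 2 * (R : ℂ) ^ 2 by ring, mul_inv]
    ring
  rw [e1, Complex.sub_re, Complex.ofReal_re, Complex.zero_re] at h0
  rw [e2, Complex.re_ofReal_mul]
  have hz2 : ‖z‖ ^ 2 ≤ R ^ 2 := pow_le_pow_left₀ (norm_nonneg z) hz 2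
  calc _ ≤ (R ^ 4)⁻¹ * (A * ‖z‖ ^ 2) :=
        mul_le_mul_of_nonneg_left (sub_nonneg.1 h0) (by positivity)
    _ ≤ (R ^ 4)⁻¹ * (A * R ^ 2) := by gcongr
    _ = A / R ^ 2 := by field_simp

theorem SmoothForNegTime.contDiff_slice {E F : Type*} [NormedAddCommGroup E] [NormedSpace ℝ E]
    [NormedAddCommGroup F] [NormedSpace ℝ F] {u : ℝ → E → F} (hu : SmoothForNegTime u) {t : ℝ}
    (ht : t < 0) : ContDiff ℝ ∞ (u t) :=
  contDiff_iff_contDiffAt.2 fun z => (hu t ht z).comp (f := fun w : E => (t, w)) z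
    (contDiffAt_const.prodMk contDiffAt_id)

theorem smoothForNegTime_of_contDiffOn {E F : Type*} [NormedAddCommGroup E] [NormedSpace ℝ E]
    [NormedAddCommGroup F] [NormedSpace ℝ F] {u : ℝ → E → F}
    (hu : ContDiffOn ℝ ∞ (fun p : ℝ × E => u p.1 p.2) (Iic (0 : ℝ) ×ˢ (univ : Set E))) :
    SmoothForNegTime u := fun _ ht _ =>
  hu.contDiffAt (prod_mem_nhds (Iic_mem_nhds ht) univ_mem)

theorem continuousAt_gradSq {g : ℝ → MatrixField n} {f : ℝ → Cn n → ℂ}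
    (hg : ∀ i j, SmoothForNegTime fun t z => g t z i j) (hf : SmoothForNegTime f)
    {t : ℝ} (ht : t < 0) {z : Cn n} (hdet : (g t z).det ≠ 0) :
    ContinuousAt (fun p : ℝ × Cn n => gradSq (g p.1) (f p.1) p.2) (t, z) := by
  have h1 : ContinuousAt (fun p : ℝ × Cn n => g p.1 p.2) (t, z) :=
    continuousAt_pi.2 fun i => continuousAt_pi.2 fun j => (hg i j t ht z).continuousAt
  have h2 : ContinuousAt (fun p : ℝ × Cn n => (g p.1 p.2)⁻¹) (t, z) := by
    have h3 : ContinuousAt Ring.inverse (g t z).det := by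
      rw [Ring.inverse_eq_inv']; exact continuousAt_inv₀ hdet
    exact ContinuousAt.comp (f := fun p : ℝ × Cn n => g p.1 p.2)
      (continuousAt_matrix_inv _ h3) h1
  have h4 : ∀ i j, ContinuousAt (fun p : ℝ × Cn n => (g p.1 p.2)⁻¹ i j) (t, z) := fun i j =>
    continuousAt_pi.1 (continuousAt_pi.1 h2 i) j
  have h5 : ∀ i, ContinuousAt (fun p : ℝ × Cn n => wirtinger (-I) i (f p.1) p.2) (t, z) :=
    fun i => (hf.wirtinger (-I) i t ht z).continuousAt
  simp only [gradSq, Matrix.mul_apply, conjTranspose_apply, gradCol, of_apply]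
  exact tendsto_finsetSum _ fun i _ => (tendsto_finsetSum _ fun j _ =>
    (h5 j).star.mul (h4 j i)).mul (h5 i)

end

/-! ### The gradient estimate and the vanishing of the gradient. -/

section

open Matrix Filter Topology

/-- Bernstein estimate: the gradient at time `t` of a solution bounded by `B` on `[t - T, t]`. -/
theorem gradSq_le {g : ℝ → MatrixField 2} (hg : IsAncientPluriclosedFlow g) {A : ℝ}
    (hA : 0 < A) (hequiv : UniformlyEuclidean A g) {f : ℝ → Cn 2 → ℝ} (hf : SmoothForNegTime f)
    (hheat : ∀ t < 0, ∀ z, HasDerivAt (fun s => (f s z : ℂ))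
      (chernLaplacian (g t) (fun w => (f t w : ℂ)) z) t)
    {B : ℝ} (hB : ∀ t < 0, ∀ z, |f t z| ≤ B) {t : ℝ} (ht : t < 0) {T : ℝ} (hT : 0 < T)
    (z₀ : Cn 2) :
    T * (gradSq (g t) (fun w => (f t w : ℂ)) z₀).re ≤ 4 * (B ^ 2 + 1) := by
  have hfC : SmoothForNegTime fun s w => (f s w : ℂ) := fun s hs w =>
    ofRealCLM.contDiff.contDiffAt.comp (f := fun p : ℝ × Cn 2 => f p.1 p.2) (s, w) (hf s hs w)
  have hgs : ∀ i j, SmoothForNegTime fun t z => g t z i j := fun i j =>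
    smoothForNegTime_of_contDiffOn (u := fun t z => g t z i j) (hg.smooth i j)
  have hpos : ∀ s < 0, ∀ w, (g s w).PosDef := fun s hs => hg.posDef s hs.le
  have hdet : ∀ s < 0, ∀ w, (g s w).det ≠ 0 := fun s hs w => (hpos s hs w).det_pos.ne'
  let u : ℝ → Cn 2 → ℝ := fun s w => (gradSq (g s) (fun w => (f s w : ℂ)) w).re
  have hu0 : ∀ s < 0, ∀ w, 0 ≤ u s w := fun s hs w =>
    (Complex.le_def.1 (gradSq_nonneg (hpos s hs w))).1
  have huC : ∀ s < 0, gradSq (g s) (fun w => (f s w : ℂ)) = fun w => (u s w : ℂ) := fun s hs =>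
    funext fun w => Complex.ext rfl
      (by simpa using (Complex.le_def.1 (gradSq_nonneg (hpos s hs w))).2.symm)
  have hB0 : 0 ≤ B := (abs_nonneg _).trans (hB t ht z₀)
  -- `R` is taken large after `T` and `z₀`: the cutoff is then at least `1/2` at `z₀`, and the
  -- errors, of size `A / R²`, are small compared with `1 / T`.
  obtain ⟨R, hR, hRz, hRT⟩ : ∃ R : ℝ, 0 < R ∧ ‖z₀‖ ^ 2 / R ^ 2 ≤ 1 / 2 ∧
      T * (A / R ^ 2) * (12 + 32 * B ^ 2) < 1 / 2 := by
    have hM : 0 < 2 * (T * A * (12 + 32 * B ^ 2)) + 1 + 2 * ‖z₀‖ ^ 2 := by positivity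
    have hp : 0 ≤ T * A * (12 + 32 * B ^ 2) := by positivity
    refine ⟨√(2 * (T * A * (12 + 32 * B ^ 2)) + 1 + 2 * ‖z₀‖ ^ 2), Real.sqrt_pos.2 hM, ?_, ?_⟩
    · rw [Real.sq_sqrt hM.le, div_le_iff₀ hM]; linarith
    · rw [Real.sq_sqrt hM.le, mul_div_assoc', div_mul_eq_mul_div, div_lt_iff₀ hM]
      have := sq_nonneg ‖z₀‖
      linarith
  let ψ : Cn 2 → ℝ := cutoff R
  let Φ : ℝ × Cn 2 → ℝ := fun p =>
    (p.1 - (t - T)) * (ψ p.2 * ψ p.2 * u p.1 p.2) + f p.1 p.2 * f p.1 p.2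
  have hzR : ‖z₀‖ ≤ R := by
    rw [div_le_iff₀ (by positivity)] at hRz
    exact le_of_sq_le_sq (by nlinarith [sq_nonneg R]) hR.le
  have hmem : (t, z₀) ∈ Icc (t - T) t ×ˢ Metric.closedBall (0 : Cn 2) R :=
    ⟨⟨by simp [hT.le], le_rfl⟩, by simpa using hzR⟩
  have hcont : ContinuousOn Φ (Icc (t - T) t ×ˢ Metric.closedBall (0 : Cn 2) R) := by
    rintro ⟨s, w⟩ ⟨hs, -⟩
    have hs0 : s < 0 := hs.2.trans_lt ht
    have c1 : ContinuousAt (fun p : ℝ × Cn 2 => u p.1 p.2) (s, w) :=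
      Complex.continuous_re.continuousAt.comp (continuousAt_gradSq hgs hfC hs0 (hdet s hs0 w))
    have c2 : ContinuousAt (fun p : ℝ × Cn 2 => ψ p.2) (s, w) :=
      ((contDiff_cutoff R).continuous.comp continuous_snd).continuousAt
    have c3 : ContinuousAt (fun p : ℝ × Cn 2 => f p.1 p.2) (s, w) := (hf s hs0 w).continuousAt
    exact (((continuousAt_fst.sub continuousAt_const).mul ((c2.mul c2).mul c1)).add
      (c3.mul c3)).continuousWithinAt
  obtain ⟨⟨s, z⟩, ⟨hs, hz⟩, hmax⟩ :=
    (isCompact_Icc.prod (isCompact_closedBall (0 : Cn 2) R)).exists_isMaxOn ⟨_, hmem⟩ hcont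
  simp only [Metric.mem_closedBall, dist_zero_right] at hz
  replace hmax : ∀ s' ∈ Icc (t - T) t, ∀ w : Cn 2, ‖w‖ ≤ R → Φ (s', w) ≤ Φ (s, z) :=
    fun s' hs' w hw => hmax (⟨hs', by simpa using hw⟩ :
      (s', w) ∈ Icc (t - T) t ×ˢ Metric.closedBall (0 : Cn 2) R)
  have hs0 : s < 0 := hs.2.trans_lt ht
  -- If the maximum is at most `B² + 1`, evaluating at `(t, z₀)`, where the time weight is `T` and
  -- `ψ² ≥ 1/4`, gives the factor `4`. Otherwise `f² ≤ B²` forces `τ ψ² u > 1`, the largeness needed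
  -- for the contradiction.
  by_cases hΦ : Φ (s, z) ≤ B ^ 2 + 1
  · have h1 := (hmax t ⟨by linarith, le_rfl⟩ z₀ hzR).trans hΦ
    have h2 : 1 / 2 ≤ ψ z₀ := by simp only [ψ, cutoff]; linarith
    have h3 : 0 ≤ T * u t z₀ := mul_nonneg hT.le (hu0 t ht z₀)
    have h4 : 1 / 4 ≤ ψ z₀ * ψ z₀ := by nlinarith
    have h5 := mul_le_mul_of_nonneg_right h4 h3
    have h6 : (t - (t - T)) * (ψ z₀ * ψ z₀ * u t z₀) + f t z₀ * f t z₀ ≤ B ^ 2 + 1 := h1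
    have h7 := mul_self_nonneg (f t z₀)
    change T * u t z₀ ≤ _
    linarith
  · exfalso
    have hfB : f s z * f s z ≤ B ^ 2 := by
      rw [← sq]; exact sq_le_sq' (abs_le.1 (hB s hs0 z)).1 (abs_le.1 (hB s hs0 z)).2
    have hlarge : 1 < (s - (t - T)) * (ψ z * ψ z * u s z) := by
      have : Φ (s, z) = (s - (t - T)) * (ψ z * ψ z * u s z) + f s z * f s z := rfl
      linarith
    have hψnn : 0 ≤ ψ z := by
      have : ‖z‖ ^ 2 / R ^ 2 ≤ 1 :=
        div_le_one_of_le₀ (pow_le_pow_left₀ (norm_nonneg z) hz 2) (by positivity)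
      simp only [ψ, cutoff]; linarith
    -- As `τ ψ² u > 1`, none of the three factors vanishes: the maximum lies off the boundary sphere
    -- and after the initial time, hence is local in space and has earlier times to compare with.
    have hψ0 : 0 < ψ z := hψnn.lt_of_ne fun h => by
      rw [← h] at hlarge; norm_num at hlarge
    have hus : 0 < u s z := (hu0 s hs0 z).lt_of_ne fun h => by
      rw [← h] at hlarge; norm_num at hlarge
    have hτ0 : 0 < s - (t - T) := (sub_nonneg.2 hs.1).lt_of_ne fun h => by
      rw [← h] at hlarge; norm_num at hlarge
    have hψ1 : ψ z ≤ 1 := by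
      have : 0 ≤ ‖z‖ ^ 2 / R ^ 2 := by positivity
      simp only [ψ, cutoff]; linarith
    have hzlt : ‖z‖ < R := hz.lt_of_ne fun h => by
      simp [ψ, cutoff, h, hR.ne'] at hψ0
    have hloc : IsLocalMax (fun w => (s - (t - T)) * (ψ w * ψ w * u s w) + f s w * f s w) z := by
      filter_upwards [(continuous_norm.continuousAt (x := z)).eventually (Iio_mem_nhds hzlt)]
        with w hw
      exact hmax s hs w (le_of_lt hw)
    have cf : ContDiff ℝ ∞ (f s) := hf.contDiff_slice hs0
    have cu : ContDiff ℝ ∞ (u s) := reCLM.contDiff.comp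
      (contDiff_gradSq (hg.smoothMatrix hs0.le) (hdet s hs0) (contDiff_ofReal_comp cf))
    obtain ⟨hgrad, hlap, hquad⟩ := conditions_of_isLocalMax (contDiff_cutoff R) cu cf
      (hpos s hs0 z) hloc rfl rfl rfl
    have hff : (gradPair (g s) (fun w => (f s w : ℂ)) (fun w => (f s w : ℂ)) z).re = u s z := by
      rw [← gradSq_eq_gradPair _ cf]
    rw [hff] at hlap
    simp only [hff] at hquad
    obtain ⟨u', hu', hu'le⟩ := exists_hasDerivAt_gradSq hg hfC hs0 (contDiff_ofReal_comp cf)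
      (hheat s hs0) z
    rw [huC s hs0] at hu'le
    have hut : u'.re ≤ (chernLaplacian (g s) (fun w => (u s w : ℂ)) z).re := by
      have := (Complex.le_def.1 hu'le).1
      rw [Complex.sub_re, Complex.zero_re] at this
      linarith
    have du : HasDerivAt (fun s' => u s' z) u'.re s :=
      reCLM.hasFDerivAt.comp_hasDerivAt s hu'
    have df : HasDerivAt (fun s' => f s' z)
        (chernLaplacian (g s) (fun w => (f s w : ℂ)) z).re s :=
      reCLM.hasFDerivAt.comp_hasDerivAt s (hheat s hs0 z)
    have dΦ := (((hasDerivAt_id s).sub_const (t - T)).mul (du.const_mul (ψ z * ψ z))).add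
      (df.mul df)
    have htime := nonneg_of_hasDerivAt_of_le (sub_pos.1 hτ0) dΦ fun s' hs' =>
      hmax s' ⟨hs'.1, hs'.2.trans hs.2⟩ z hz
    have hHA := posSemidef_smul_one_sub_inv hA (hpos s hs0 z) (hequiv s hs0.le z).1
    refine bernstein_contradiction (T := T) (B := B) (δ := A / R ^ 2) hgrad hlap hquad ?_ hut hψ0
      hψ1 hτ0 (by linarith [hs.2]) hus ?_ (hB s hs0 z) ?_
      (gradPair_cutoff_le hA.le hR hz hHA) ?_ hRT
    · simp only [id] at htime
      change 0 ≤ ψ z ^ 2 * u s z + (s - (t - T)) * (ψ z ^ 2 * u'.re)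
        + 2 * f s z * (chernLaplacian (g s) (fun w => (f s w : ℂ)) z).re
      linarith
    · change 1 ≤ _ * ψ z ^ 2 * u s z
      linarith
    · rw [← gradSq_eq_gradPair _ (contDiff_cutoff R)]
      exact (Complex.le_def.1 (gradSq_nonneg (hpos s hs0 z))).1
    -- The dimension factor `n = 2` is the `2` in front of `δ`.
    · exact_mod_cast neg_chernLaplacian_cutoff_le hHA

theorem gradCol_eq_zero_of_gradSq_eq_zero {g : MatrixField n} {f : Cn n → ℂ} {z : Cn n}
    (hg : (g z).PosDef) (h : gradSq g f z = 0) (i : Fin n) : wirtinger (-I) i f z = 0 := by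
  by_contra hne
  have hv : (fun i => gradCol f z i 0) ≠ 0 := fun h0 => hne (congrFun h0 i)
  have h1 := hg.inv.dotProduct_mulVec_pos hv
  have h2 : star (fun i => gradCol f z i 0) ⬝ᵥ (g z)⁻¹ *ᵥ (fun i => gradCol f z i 0)
      = gradSq g f z := by
    simp only [gradSq, dotProduct, mulVec, Matrix.mul_apply, conjTranspose_apply, Pi.star_apply,
      Finset.mul_sum, Finset.sum_mul]
    rw [Finset.sum_comm]
    exact Finset.sum_congr rfl fun k _ => Finset.sum_congr rfl fun l _ => by ring
  rw [h2, h] at h1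
  exact lt_irrefl _ h1

theorem fderiv_eq_zero_of_wirtinger_eq_zero {φ : Cn n → ℝ} (hφ : ContDiff ℝ ∞ φ) {z : Cn n}
    (h : ∀ i, wirtinger (-I) i (fun w => (φ w : ℂ)) z = 0) : fderiv ℝ φ z = 0 := by
  have h1 : ∀ i, fderiv ℝ φ z (EuclideanSpace.single i 1) = 0
      ∧ fderiv ℝ φ z (EuclideanSpace.single i I) = 0 := by
    intro i
    have := h i
    rw [wirtinger_ofReal _ _ hφ] at this
    have hre := congrArg Complex.re this
    have him := congrArg Complex.im this
    simp at hre him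
    exact ⟨hre, him⟩
  ext v
  have hv : axisSum (fun k => v k) = v := by
    ext j; simp [axisSum, Finset.sum_apply]
  have := map_axisSum (fderiv ℝ φ z : Cn n →ₗ[ℝ] ℝ) (fun k => v k)
  rw [hv] at this
  simpa [h1] using this

end

end HermitianFlow

end

/-! ### The Liouville theorem. -/

theorem mainTheorem9 (g : ℝ → HermitianFlow.MatrixField 2)
    (hg : HermitianFlow.IsAncientPluriclosedFlow g)
    (A : ℝ) (hA : 0 < A) (hequiv : HermitianFlow.UniformlyEuclidean A g)
    (hCk : HermitianFlow.UniformCkBounds g)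
    (f : ℝ → HermitianFlow.Cn 2 → ℝ)
    (hf : ContDiffOn ℝ ∞ (fun p : ℝ × HermitianFlow.Cn 2 => f p.1 p.2)
      (Iic (0 : ℝ) ×ˢ (univ : Set (HermitianFlow.Cn 2))))
    (hheat : ∀ t ≤ 0, ∀ z : HermitianFlow.Cn 2,
      HasDerivWithinAt (fun s => (f s z : ℂ))
        (HermitianFlow.chernLaplacian (g t) (fun w => (f t w : ℂ)) z) (Iic (0 : ℝ)) t)
    (hbdd : ∃ B : ℝ, ∀ t ≤ 0, ∀ z : HermitianFlow.Cn 2, |f t z| ≤ B) :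
    ∃ c : ℝ, ∀ t ≤ 0, ∀ z : HermitianFlow.Cn 2, f t z = c := by
  open HermitianFlow in
  obtain ⟨B, hB⟩ := hbdd
  have hfs : SmoothForNegTime f := smoothForNegTime_of_contDiffOn hf
  have hheat' : ∀ t < 0, ∀ z, HasDerivAt (fun s => (f s z : ℂ))
      (chernLaplacian (g t) (fun w => (f t w : ℂ)) z) t := fun t ht z =>
    (hheat t ht.le z).hasDerivAt (Iic_mem_nhds ht)
  have hgrad : ∀ t < 0, ∀ z, gradSq (g t) (fun w => (f t w : ℂ)) z = 0 := by
    intro t ht z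
    have hnn := Complex.le_def.1
      (gradSq_nonneg (φ := fun w => (f t w : ℂ)) (hg.posDef t ht.le z))
    refine Complex.ext ?_ hnn.2.symm
    by_contra hne
    have hpos : 0 < (gradSq (g t) (fun w => (f t w : ℂ)) z).re :=
      lt_of_le_of_ne hnn.1 (Ne.symm hne)
    set r := (gradSq (g t) (fun w => (f t w : ℂ)) z).re with hr
    -- If the gradient had squared norm `r > 0`, this `T` would give `T r = 4(B² + 1) + 1`, one more
    -- than the estimate permits.
    have h := gradSq_le hg hA hequiv hfs hheat' (fun t ht => hB t ht.le) ht
      (T := (4 * (B ^ 2 + 1) + 1) / r) (by positivity) z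
    rw [← hr, div_mul_cancel₀ _ hpos.ne'] at h
    linarith
  have hfd : ∀ t < 0, ∀ z, fderiv ℝ (f t) z = 0 := fun t ht z =>
    fderiv_eq_zero_of_wirtinger_eq_zero (hfs.contDiff_slice ht) fun i =>
      gradCol_eq_zero_of_gradSq_eq_zero (hg.posDef t ht.le z) (hgrad t ht z) i
  have hspace : ∀ t < 0, ∀ z, f t z = f t 0 := fun t ht z =>
    is_const_of_fderiv_eq_zero ((hfs.contDiff_slice ht).differentiable (by simp)) (hfd t ht) z 0
  have hcont : ContinuousOn (fun s => f s 0) (Iic 0) := fun s hs =>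
    Complex.continuous_re.continuousAt.comp_continuousWithinAt (hheat s hs 0).continuousWithinAt
  have hderiv : ∀ t < 0, HasDerivAt (fun s => f s 0) 0 t := by
    intro t ht
    have h1 : (fun w => (f t w : ℂ)) = fun _ => (f t 0 : ℂ) := funext fun w => by
      rw [hspace t ht w]
    have h2 := hheat' t ht 0
    rw [h1, chernLaplacian_eq] at h2
    have h3 : ∀ k l, wirtinger (-I) k (wirtinger I l fun _ : Cn 2 => (f t 0 : ℂ)) 0 = 0 :=
      fun k l => by
        rw [wirtinger_const]
        exact congrFun (wirtinger_const (-I) k 0) 0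
    simp only [h3, mul_zero, Finset.sum_const_zero] at h2
    exact reCLM.hasFDerivAt.comp_hasDerivAt t h2
  have htime : ∀ t ≤ 0, f t 0 = f 0 0 := by
    intro t ht
    have hc : ContinuousOn (fun s => f s 0) (Icc t 0) := hcont.mono fun s hs => hs.2
    exact (constant_of_has_deriv_right_zero hc (fun s hs =>
      (hderiv s hs.2).hasDerivWithinAt) 0 ⟨ht, le_rfl⟩).symm
  refine ⟨f 0 0, fun t ht z => ?_⟩
  rcases ht.lt_or_eq with ht | rfl
  · rw [hspace t ht z, htime t ht.le]
  -- The gradient argument covers negative times only; at `t = 0` the value at each `z` is the limit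
  -- from the left, by continuity in time.
  · have hcz : ContinuousWithinAt (fun s => f s z) (Iio 0) 0 :=
      (Complex.continuous_re.continuousAt.comp_continuousWithinAt
        (hheat 0 le_rfl z).continuousWithinAt).mono Iio_subset_Iic_self
    refine tendsto_nhds_unique hcz (tendsto_const_nhds.congr' ?_)
    filter_upwards [self_mem_nhdsWithin] with s hs
    rw [hspace s hs z, htime s (le_of_lt hs)]
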